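/- Let $n\ge 1$ and let $\mathrm{SU}(n,1)$ be the group of complex $(n+1)\times(n+1)$ matrices of determinant $1$ preserving the Hermitian form $\hat h(X,Y)=\sum_{i=1}^{n-1}\overline{Y_i}X_i+\overline{Y_{n+1}}X_n+\overline{Y_n}X_{n+1}$, acting on the complex hyperbolic space $\mathbb{C}\mathrm{H}(n)=\{[x]\in\mathbb{C}P^n:\hat h(x,x)<0\}$, with base point $o=[0:\dots:0:1:-1]$. Let $A_0=\mathrm{diag}(0,\dots,0,1,-1)$, $A=\exp(\mathbb{R}A_0)\cong\mathbb{R}$, let $N=\exp\mathfrak{n}$, where $$\mathfrak{n}=\left\{\begin{pmatrix}0&0&v\\-v^*&0&ib\\0&0&0\end{pmatrix}: v\in\mathbb{C}^{n-1},\ b\in\mathbb{R}\right\},$$ let $N_2\in\mathfrak{n}$ be the element with $v=0$, $b=1$, and let $\mathrm{S}(\mathrm{U}(n-1)\mathrm{U}(1))$ be the group of the matrices $\mathrm{diag}(B,z,z)$ of determinant $1$ with $B\in\mathrm{U}(n-1)$, $|z|=1$. A non-symmetric homogeneous description of $\mathbb{C}\mathrm{H}(n)$ is $\mathbb{C}\mathrm{H}(n)=G/H$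 with $G=FN$ and $H=F\cap\mathrm{S}(\mathrm{U}(n-1)\mathrm{U}(1))$, where $F$ is a connected closed subgroup of $\mathrm{S}(\mathrm{U}(n-1)\mathrm{U}(1))A$ with non-trivial projection to $A\cong\mathbb{R}$. Let $\mathfrak{g},\mathfrak{h},\mathfrak{f}$ be the Lie algebras of $G,H,F$, and let $\mathfrak{m}\subset\mathfrak{g}$ be a subspace with $\mathfrak{g}=\mathfrak{h}\oplus\mathfrak{m}$ and $\mathrm{Ad}(H)\mathfrak{m}\subset\mathfrak{m}$. The canonical connection $\tilde\nabla$ of this reductive decomposition is the $G$-invariant affine connection on $\mathbb{C}\mathrm{H}(n)$ such that $(\tilde\nabla_{B^*}C^*)_o=-([B,C]_{\mathfrak m})^*_o$ for all $B,C\in\mathfrak{m}$, where $X^*$ is the vector field $X^*_p=\frac{d}{dt}\big|_{t=0}\exp(tX)p$. Let $A_r$ be the element of $\mathfrak{f}\cap\big(A_0+\mathfrak{s}(\mathfrak{u}(n-1)+\mathfrak{u}(1))\big)$ orthogonal to $\mathfrak{h}$ with respect to $k(E,E')=\mathrm{Re}\,\mathrm{tr}(E^*E')$, and let $\tilde A_0$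 and $\tilde N_2$ be the elements of $\mathfrak{m}$ with $\tilde A_0-A_r\in\mathfrak{h}$ and $\tilde N_2-N_2\in\mathfrak{h}$. Then for every non-symmetric homogeneous description and every canonical connection $\tilde\nabla$ as above, these elements exist, there are smooth $G$-invariant vector fields $U$ and $V$ on $\mathbb{C}\mathrm{H}(n)$ with $U_o=(\tilde A_0)^*_o$ and $V_o=(\tilde N_2)^*_o$, and $U$ and $V$ are parallel, $\tilde\nabla U=\tilde\nabla V=0$, vanish nowhere, and are linearly independent over $\mathbb{R}$ at every point. -/

import Mathlib

open scoped Manifold ContDiff Matrix LinearAlgebra.Projectivization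

noncomputable section

namespace ComplexHyperbolic

/-! ## The Hermitian form and complex hyperbolic space

Throughout, `m` is a natural number and the complex hyperbolic space in question is
`ℂH(n)` with `n = m + 1 ≥ 1`. Vectors of `ℂ^(n+1) = ℂ^(n-1) × ℂ²` are indexed by
`Fin m ⊕ Fin 2`. -/

/-- The index set of the coordinates of `ℂ^(n+1)`, `n = m + 1`. -/
abbrev Idx (m : ℕ) : Type := Fin m ⊕ Fin 2

/-- Complex matrices of size `n + 1`. -/
abbrev Mat (m : ℕ) : Type := Matrix (Idx m) (Idx m) ℂ

/-- The matrix `diag(Id, (0 1; 1 0))` of the Hermitian form of signature `(n, 1)`. -/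
def Q (m : ℕ) : Mat m := Matrix.fromBlocks 1 0 0 !![0, 1; 1, 0]

/-- The Hermitian form
`ĥ(X, Y) = ∑ i < n, conj Y_i * X_i + conj Y_(n+1) * X_n + conj Y_n * X_(n+1)`. -/
def herm {m : ℕ} (X Y : Idx m → ℂ) : ℂ :=
  ∑ i, star (Y (.inl i)) * X (.inl i)
    + star (Y (.inr 1)) * X (.inr 0) + star (Y (.inr 0)) * X (.inr 1)

/-- Complex hyperbolic space `ℂH(m + 1)`: the set of the complex lines in `ℂ^(m+2)` that are
spanned by a vector `v` with `ĥ(v, v) < 0` (the number `ĥ(v, v)` is real). -/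
def CH (m : ℕ) : Type :=
  {p : ℙ ℂ (Idx m → ℂ) // ∃ (v : Idx m → ℂ) (hv : v ≠ 0),
    Projectivization.mk ℂ v hv = p ∧ (herm v v).re < 0}

/-- The model space `ℂ^(n-1) × ℂ`, regarded as a real vector space. -/
abbrev Model (m : ℕ) : Type := (Fin m → ℂ) × ℂ

/-- The affine coordinates `[x] ↦ (x_1 / x_(n+1), …, x_n / x_(n+1))`. -/
def affine {m : ℕ} (p : CH m) : Model m :=
  (fun i => p.1.rep (.inl i) / p.1.rep (.inr 1), p.1.rep (.inr 0) / p.1.rep (.inr 1))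

theorem herm_self_re {m : ℕ} (v : Idx m → ℂ) :
    (herm v v).re = ∑ i, ‖v (.inl i)‖ ^ 2 + 2 * (star (v (.inr 1)) * v (.inr 0)).re := by
  have h1 : ∀ z : ℂ, (star z * z).re = ‖z‖ ^ 2 := fun z => by
    rw [Complex.star_def, Complex.conj_mul']
    norm_cast
  simp only [herm, Complex.add_re, Complex.re_sum, h1]
  simp only [Complex.star_def, Complex.mul_re, Complex.conj_re, Complex.conj_im]
  ring

theorem herm_smul_self_re {m : ℕ} (c : ℂ) (v : Idx m → ℂ) :
    (herm (c • v) (c • v)).re = ‖c‖ ^ 2 * (herm v v).re := by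
  have h : star c * c = ((‖c‖ ^ 2 : ℝ) : ℂ) := by
    rw [Complex.star_def, Complex.conj_mul']
    norm_cast
  have : herm (c • v) (c • v) = ((‖c‖ ^ 2 : ℝ) : ℂ) * herm v v := by
    rw [← h]
    simp only [herm, Pi.smul_apply, smul_eq_mul, star_mul', mul_add, Finset.mul_sum]
    congr 1
    · congr 1
      · exact Finset.sum_congr rfl fun i _ => by ring
      · ring
    · ring
  rw [this, Complex.re_ofReal_mul]

theorem last_ne_zero {m : ℕ} {v : Idx m → ℂ} (h : (herm v v).re < 0) : v (.inr 1) ≠ 0 := by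
  intro h0
  rw [herm_self_re, h0] at h
  simp only [star_zero, zero_mul, Complex.zero_re, mul_zero, add_zero] at h
  exact absurd h (not_lt.mpr (Finset.sum_nonneg fun i _ => by positivity))

theorem rep_neg {m : ℕ} (p : CH m) : (herm p.1.rep p.1.rep).re < 0 := by
  obtain ⟨p, v, hv, rfl, h⟩ := p
  obtain ⟨a, ha⟩ := Projectivization.exists_smul_eq_mk_rep ℂ v hv
  have ha' : (Projectivization.mk ℂ v hv).rep = (a : ℂ) • v := ha.symm
  simp only [ha', herm_smul_self_re]
  have : 0 < ‖(a : ℂ)‖ := norm_pos_iff.mpr a.ne_zero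
  have : 0 < ‖(a : ℂ)‖ ^ 2 := by positivity
  nlinarith

/-- The point of `ℂH(m + 1)` with a given negative representative. -/
def CH.mk {m : ℕ} (v : Idx m → ℂ) (h : (herm v v).re < 0) : CH m :=
  ⟨Projectivization.mk ℂ v fun h0 => last_ne_zero h (by rw [h0]; rfl), v, _, rfl, h⟩

theorem affine_mk {m : ℕ} (v : Idx m → ℂ) (h : (herm v v).re < 0) :
    affine (CH.mk v h) = (fun i => v (.inl i) / v (.inr 1), v (.inr 0) / v (.inr 1)) := by
  have hv : v ≠ 0 := fun h0 => last_ne_zero h (by rw [h0]; rfl)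
  obtain ⟨a, ha⟩ := Projectivization.exists_smul_eq_mk_rep ℂ v hv
  have ha' : (CH.mk v h).1.rep = (a : ℂ) • v := ha.symm
  have := a.ne_zero
  simp only [affine, ha', Pi.smul_apply, smul_eq_mul]
  refine Prod.ext (funext fun i => ?_) ?_ <;> exact mul_div_mul_left _ _ this

/-- The Siegel domain, the image of the affine coordinates. -/
def siegel (m : ℕ) : Set (Model m) := {q | ∑ i, ‖q.1 i‖ ^ 2 + 2 * q.2.re < 0}

/-- The vector `(w, ζ, 1)`. -/
def lift {m : ℕ} (q : Model m) : Idx m → ℂ := Sum.elim q.1 ![q.2, 1]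

theorem herm_lift {m : ℕ} (q : Model m) :
    (herm (lift q) (lift q)).re = ∑ i, ‖q.1 i‖ ^ 2 + 2 * q.2.re := by
  rw [herm_self_re]
  simp [lift]

theorem affine_injective {m : ℕ} : Function.Injective (affine (m := m)) := by
  intro p q hpq
  have hp := last_ne_zero (rep_neg p)
  have hq := last_ne_zero (rep_neg q)
  obtain ⟨h1, h2⟩ := Prod.ext_iff.mp hpq
  apply Subtype.ext
  rw [← p.1.mk_rep, ← q.1.mk_rep, Projectivization.mk_eq_mk_iff']
  refine ⟨p.1.rep (.inr 1) / q.1.rep (.inr 1), funext fun i => ?_⟩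
  simp only [Pi.smul_apply, smul_eq_mul]
  rcases i with i | i
  · have := congrFun h1 i
    simp only [affine] at this
    field_simp at this ⊢
    linear_combination -this
  · fin_cases i
    · simp only [affine] at h2
      simp only [Fin.zero_eta]
      field_simp at h2 ⊢
      linear_combination -h2
    · simp only [Fin.mk_one]
      field_simp

theorem range_affine {m : ℕ} : Set.range (affine (m := m)) = siegel m := by
  ext q
  constructor
  · rintro ⟨p, rfl⟩
    have hp := rep_neg p
    have h1 := last_ne_zero hp
    have : lift (affine p) = (p.1.rep (.inr 1))⁻¹ • p.1.rep := by
      funext i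
      rcases i with i | i
      · simp [lift, affine, div_eq_inv_mul]
      · fin_cases i
        · simp [lift, affine, div_eq_inv_mul]
        · simp [lift, h1]
    change ∑ i, ‖(affine p).1 i‖ ^ 2 + 2 * (affine p).2.re < 0
    rw [← herm_lift, this, herm_smul_self_re]
    have : 0 < ‖(p.1.rep (.inr 1))⁻¹‖ := norm_pos_iff.mpr (inv_ne_zero h1)
    have : 0 < ‖(p.1.rep (.inr 1))⁻¹‖ ^ 2 := by positivity
    nlinarith
  · intro hq
    have h : (herm (lift q) (lift q)).re < 0 := by rw [herm_lift]; exact hq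
    refine ⟨CH.mk (lift q) h, ?_⟩
    rw [affine_mk]
    refine Prod.ext (funext fun i => ?_) ?_ <;> simp [lift]

/-- The topology of `ℂH(n)` is the one of the affine coordinates (equivalently, the one induced
from complex projective space, whose affine charts are homeomorphisms onto open sets). -/
instance (m : ℕ) : TopologicalSpace (CH m) :=
  TopologicalSpace.induced affine inferInstance

theorem isOpen_siegel (m : ℕ) : IsOpen (siegel m) := by
  refine isOpen_lt ?_ continuous_const
  refine Continuous.add (continuous_finsetSum _ fun i _ => ?_) ?_
  · exact (((continuous_apply i).comp continuous_fst).norm).pow 2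
  · exact continuous_const.mul (Complex.continuous_re.comp continuous_snd)

theorem isOpenEmbedding_affine (m : ℕ) : Topology.IsOpenEmbedding (affine (m := m)) where
  eq_induced := rfl
  injective := affine_injective
  isOpen_range := by rw [range_affine]; exact isOpen_siegel m

/-- The base point `o = [0 : … : 0 : 1 : -1]`. -/
def basePoint (m : ℕ) : CH m :=
  CH.mk (Sum.elim 0 ![1, -1]) (by rw [herm_self_re]; norm_num)

instance (m : ℕ) : Nonempty (CH m) := ⟨basePoint m⟩

/-- The affine coordinates are a global chart of `ℂH(n)`. -/
instance (m : ℕ) : ChartedSpace (Model m) (CH m) :=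
  (isOpenEmbedding_affine m).singletonChartedSpace

instance (m : ℕ) : IsManifold 𝓘(ℝ, Model m) ∞ (CH m) :=
  (isOpenEmbedding_affine m).isManifold_singleton

/-! ## The group `SU(n, 1)` and its Lie algebra -/

/-- The group `SU(n, 1)` of the matrices of determinant `1` that preserve the form `ĥ`. -/
def SU (m : ℕ) : Subgroup (Matrix.SpecialLinearGroup (Idx m) ℂ) where
  carrier := {g | (g : Mat m)ᴴ * Q m * (g : Mat m) = Q m}
  one_mem' := by simp
  mul_mem' {g h} hg hh := by
    simp only [Set.mem_ofPred_eq, Matrix.SpecialLinearGroup.coe_mul,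
      Matrix.conjTranspose_mul] at *
    calc _ = (h : Mat m)ᴴ * ((g : Mat m)ᴴ * Q m * (g : Mat m)) * (h : Mat m) := by
            simp only [Matrix.mul_assoc]
      _ = Q m := by rw [hg, hh]
  inv_mem' {g} hg := by
    simp only [Set.mem_ofPred_eq] at *
    have h1 : (g : Mat m) * ((g⁻¹ : Matrix.SpecialLinearGroup (Idx m) ℂ) : Mat m) = 1 := by
      rw [← Matrix.SpecialLinearGroup.coe_mul, mul_inv_cancel,
        Matrix.SpecialLinearGroup.coe_one]
    have h2 : (((g⁻¹ : Matrix.SpecialLinearGroup (Idx m) ℂ) : Mat m))ᴴ * (g : Mat m)ᴴ = 1 := by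
      rw [← Matrix.conjTranspose_mul, h1, Matrix.conjTranspose_one]
    nth_rewrite 1 [← hg]
    calc _ = ((((g⁻¹ : Matrix.SpecialLinearGroup (Idx m) ℂ) : Mat m))ᴴ * (g : Mat m)ᴴ) * Q m
          * ((g : Mat m) * ((g⁻¹ : Matrix.SpecialLinearGroup (Idx m) ℂ) : Mat m)) := by
            simp only [Matrix.mul_assoc]
      _ = Q m := by rw [h1, h2]; simp

theorem herm_eq {m : ℕ} (X Y : Idx m → ℂ) : herm X Y = star Y ⬝ᵥ (Q m *ᵥ X) := by
  simp [herm, Q, dotProduct, Matrix.mulVec, Matrix.fromBlocks, Fintype.sum_sum_type,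
    Matrix.one_apply, Fin.sum_univ_two]
  ring

theorem herm_mulVec {m : ℕ} (g : SU m) (X Y : Idx m → ℂ) :
    herm ((g.1 : Mat m) *ᵥ X) ((g.1 : Mat m) *ᵥ Y) = herm X Y := by
  have hg : (g.1 : Mat m)ᴴ * Q m * (g.1 : Mat m) = Q m := g.2
  rw [herm_eq, herm_eq, Matrix.star_mulVec, ← Matrix.dotProduct_mulVec, Matrix.mulVec_mulVec,
    Matrix.mulVec_mulVec]
  exact congrArg (fun A : Mat m => star Y ⬝ᵥ (A *ᵥ X)) hg

/-- `SU(n, 1)` acts on `ℂH(n)`, by the action of matrices on complex lines. -/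
instance (m : ℕ) : MulAction (SU m) (CH m) where
  smul g p := ⟨g.1 • p.1, by
    obtain ⟨p, v, hv, rfl, h⟩ := p
    have hgv : g.1 • v ≠ 0 := (smul_ne_zero_iff_ne g.1).mpr hv
    refine ⟨g.1 • v, hgv, (Projectivization.smul_mk g.1 hv).symm, ?_⟩
    have : herm (g.1 • v) (g.1 • v) = herm v v := herm_mulVec g v v
    rw [this]; exact h⟩
  one_smul p := Subtype.ext (one_smul _ p.1)
  mul_smul g h p := Subtype.ext (mul_smul g.1 h.1 p.1)

/-- The Lie algebra `su(n, 1)`, a real vector space of complex matrices. -/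
def su (m : ℕ) : Submodule ℝ (Mat m) where
  carrier := {X | Xᴴ * Q m + Q m * X = 0 ∧ X.trace = 0}
  add_mem' {X Y} hX hY := by
    refine ⟨?_, by rw [Matrix.trace_add, hX.2, hY.2, add_zero]⟩
    rw [Matrix.conjTranspose_add, add_mul, mul_add, add_add_add_comm, hX.1, hY.1, add_zero]
  zero_mem' := by simp
  smul_mem' c X hX := by
    refine ⟨?_, by rw [Matrix.trace_smul, hX.2, smul_zero]⟩
    rw [Matrix.conjTranspose_smul, star_trivial, smul_mul_assoc, mul_smul_comm, ← smul_add,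
      hX.1, smul_zero]

/-- The Lie bracket of `su(n, 1)`, the commutator of matrices. -/
def bracket {m : ℕ} (X Y : su m) : su m :=
  ⟨(X : Mat m) * (Y : Mat m) - (Y : Mat m) * (X : Mat m), by
    have h1 : (X : Mat m)ᴴ * Q m = -(Q m * X) := eq_neg_of_add_eq_zero_left X.2.1
    have h2 : (Y : Mat m)ᴴ * Q m = -(Q m * Y) := eq_neg_of_add_eq_zero_left Y.2.1
    refine ⟨?_, ?_⟩
    · rw [Matrix.conjTranspose_sub, Matrix.conjTranspose_mul,
        Matrix.conjTranspose_mul, sub_mul, mul_sub, Matrix.mul_assoc, h1, Matrix.mul_assoc, h2,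
        mul_neg, mul_neg, ← Matrix.mul_assoc, ← Matrix.mul_assoc, h1, h2]
      simp only [neg_mul, neg_neg, Matrix.mul_assoc]
      abel
    · rw [Matrix.trace_sub, Matrix.trace_mul_comm, sub_self]⟩

open scoped Matrix.Norms.Operator in
theorem det_exp_eq_one {m : ℕ} (A : Mat m) (hA : A.trace = 0) :
    (NormedSpace.exp A).det = 1 := by
  have hdet : Differentiable ℂ (fun M : Mat m => M.det) := by
    simp only [Matrix.det_apply]
    fun_prop
  have hlin : HasDerivAt (fun t : ℂ => (1 + t • A).det) 0 0 := by
    have h2 := (Matrix.det (1 + (Polynomial.X : Polynomial ℂ) •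
      A.map Polynomial.C)).hasDerivAt 0
    rw [Matrix.derivative_det_one_add_X_smul, hA] at h2
    refine h2.congr_of_eventuallyEq (Filter.Eventually.of_forall fun t => ?_)
    change Matrix.det (1 + t • A) = Polynomial.eval t _
    rw [← Polynomial.coe_evalRingHom, RingHom.map_det]
    congr 1
    ext i j
    by_cases hij : i = j <;> simp [hij] <;> exact mul_comm _ _
  have hchain : ∀ γ : ℂ → Mat m, γ 0 = 1 → HasDerivAt γ A 0 →
      HasDerivAt (fun t => (γ t).det) (fderiv ℂ (fun M : Mat m => M.det) 1 A) 0 := by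
    intro γ h0 hγ
    have := (hdet (γ 0)).hasFDerivAt.comp_hasDerivAt (0 : ℂ) hγ
    rwa [h0] at this
  have hz : fderiv ℂ (fun M : Mat m => M.det) 1 A = 0 := by
    refine (hchain (fun t => 1 + t • A) (by simp) ?_).unique hlin
    have h := ((hasDerivAt_id (0 : ℂ)).smul_const A).const_add (1 : Mat m)
    rw [one_smul] at h
    exact h
  have hexp0 : HasDerivAt (fun t : ℂ => (NormedSpace.exp (t • A)).det) 0 0 := by
    have h := hchain (fun t => NormedSpace.exp (t • A)) (by simp) (by
      have h := hasDerivAt_exp_smul_const (𝕂 := ℂ) A 0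
      rw [zero_smul, NormedSpace.exp_zero, one_mul] at h
      exact h)
    rwa [hz] at h
  have hall : ∀ s : ℂ, HasDerivAt (fun t : ℂ => (NormedSpace.exp (t • A)).det) 0 s := by
    intro s
    have hsplit : ∀ t : ℂ, (NormedSpace.exp (t • A)).det
        = (NormedSpace.exp (s • A)).det * (NormedSpace.exp ((t - s) • A)).det := by
      intro t
      rw [← Matrix.det_mul, ← Matrix.exp_add_of_commute, ← add_smul, add_sub_cancel]
      exact ((Commute.refl A).smul_left s).smul_right (t - s)
    have h1 : HasDerivAt (fun t : ℂ => (NormedSpace.exp ((t - s) • A)).det) 0 s := by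
      have h2 := HasDerivAt.comp_sub_const (f := fun t : ℂ => (NormedSpace.exp (t • A)).det)
        s s (by simpa using hexp0)
      exact h2
    have h3 := h1.const_mul (NormedSpace.exp (s • A)).det
    rw [mul_zero] at h3
    exact h3.congr_of_eventuallyEq (Filter.Eventually.of_forall hsplit)
  have := is_const_of_deriv_eq_zero (fun s => (hall s).differentiableAt)
    (fun s => (hall s).deriv) 1 0
  simpa using this

theorem exp_preserves {m : ℕ} (X : su m) :
    (NormedSpace.exp (X : Mat m))ᴴ * Q m * NormedSpace.exp (X : Mat m) = Q m := by
  have hQ : Q m * Q m = 1 := by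
    simp [Q, Matrix.fromBlocks_multiply, ← Matrix.one_fin_two]
  have hu : IsUnit (Q m) := IsUnit.of_mul_eq_one _ hQ
  have hinv : (Q m)⁻¹ = Q m := Matrix.inv_eq_left_inv hQ
  have hX : (X : Mat m)ᴴ = Q m * (-(X : Mat m)) * (Q m)⁻¹ := by
    rw [hinv, mul_neg, ← eq_neg_of_add_eq_zero_left X.2.1, Matrix.mul_assoc, hQ, mul_one]
  rw [← Matrix.exp_conjTranspose, hX, Matrix.exp_conj _ _ hu, hinv, Matrix.mul_assoc _ (Q m) (Q m),
    hQ, mul_one, Matrix.mul_assoc,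
    ← Matrix.exp_add_of_commute _ _ (Commute.neg_left (Commute.refl (X : Mat m)))]
  simp

/-- The exponential map `su(n, 1) → SU(n, 1)`. -/
def expSU {m : ℕ} (X : su m) : SU m :=
  ⟨⟨NormedSpace.exp (X : Mat m), det_exp_eq_one _ X.2.2⟩, exp_preserves X⟩

/-- The adjoint action of `SU(n, 1)` on `su(n, 1)`, `X ↦ g X g⁻¹`. -/
def Ad {m : ℕ} (g : SU m) (X : su m) : su m :=
  ⟨(g.1 : Mat m) * (X : Mat m) * ((g⁻¹ : SU m).1 : Mat m), by
    have hg : (g.1 : Mat m)ᴴ * Q m * (g.1 : Mat m) = Q m := g.2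
    have hg' : ((g⁻¹ : SU m).1 : Mat m)ᴴ * Q m * ((g⁻¹ : SU m).1 : Mat m) = Q m := (g⁻¹).2
    have h1 : (g.1 : Mat m) * ((g⁻¹ : SU m).1 : Mat m) = 1 := by
      rw [← Matrix.SpecialLinearGroup.coe_mul, ← Subgroup.coe_mul, mul_inv_cancel,
        Subgroup.coe_one, Matrix.SpecialLinearGroup.coe_one]
    have h2 : ((g⁻¹ : SU m).1 : Mat m) * (g.1 : Mat m) = 1 := by
      rw [← Matrix.SpecialLinearGroup.coe_mul, ← Subgroup.coe_mul, inv_mul_cancel,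
        Subgroup.coe_one, Matrix.SpecialLinearGroup.coe_one]
    have hQ1 : (g.1 : Mat m)ᴴ * Q m = Q m * ((g⁻¹ : SU m).1 : Mat m) := by
      calc (g.1 : Mat m)ᴴ * Q m
          = (g.1 : Mat m)ᴴ * Q m * ((g.1 : Mat m) * ((g⁻¹ : SU m).1 : Mat m)) := by
            rw [h1, mul_one]
        _ = Q m * ((g⁻¹ : SU m).1 : Mat m) := by rw [← Matrix.mul_assoc, hg]
    have hQ2 : ((g⁻¹ : SU m).1 : Mat m)ᴴ * Q m = Q m * (g.1 : Mat m) := by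
      calc ((g⁻¹ : SU m).1 : Mat m)ᴴ * Q m
          = ((g⁻¹ : SU m).1 : Mat m)ᴴ * Q m * (((g⁻¹ : SU m).1 : Mat m) * (g.1 : Mat m)) := by
            rw [h2, mul_one]
        _ = Q m * (g.1 : Mat m) := by rw [← Matrix.mul_assoc, hg']
    have hX : (X : Mat m)ᴴ * Q m = -(Q m * X) := eq_neg_of_add_eq_zero_left X.2.1
    refine ⟨?_, ?_⟩
    · rw [Matrix.conjTranspose_mul, Matrix.conjTranspose_mul]
      have : ((g⁻¹ : SU m).1 : Mat m)ᴴ * ((X : Mat m)ᴴ * (g.1 : Mat m)ᴴ) * Q m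
          = -(Q m * ((g.1 : Mat m) * (X : Mat m) * ((g⁻¹ : SU m).1 : Mat m))) := by
        calc _ = ((g⁻¹ : SU m).1 : Mat m)ᴴ * ((X : Mat m)ᴴ * ((g.1 : Mat m)ᴴ * Q m)) := by
              simp only [Matrix.mul_assoc]
          _ = ((g⁻¹ : SU m).1 : Mat m)ᴴ * ((X : Mat m)ᴴ * Q m) * ((g⁻¹ : SU m).1 : Mat m) := by
              rw [hQ1]; simp only [Matrix.mul_assoc]
          _ = -(((g⁻¹ : SU m).1 : Mat m)ᴴ * Q m * (X : Mat m) * ((g⁻¹ : SU m).1 : Mat m)) := by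
              rw [hX]; simp only [mul_neg, neg_mul, Matrix.mul_assoc]
          _ = _ := by rw [hQ2]; simp only [Matrix.mul_assoc]
      rw [this, neg_add_cancel]
    · rw [Matrix.trace_mul_comm, ← Matrix.mul_assoc, h2, one_mul]
      exact X.2.2⟩

/-- The Lie algebra of a (closed) subgroup `G` of `SU(n, 1)`: the matrices `X` whose one-parameter
subgroup `t ↦ exp (t X)` lies in `G`. -/
def lieAlg {m : ℕ} (G : Subgroup (SU m)) : Set (su m) :=
  {X | ∀ t : ℝ, expSU (t • X) ∈ G}

/-! ## The homogeneous descriptions `G = F N` -/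

/-- `A₀ = diag (0, …, 0, 1, -1)`. -/
def A0 (m : ℕ) : su m :=
  ⟨Matrix.fromBlocks 0 0 0 !![1, 0; 0, -1], by
    refine ⟨?_, ?_⟩
    · rw [Q, Matrix.fromBlocks_conjTranspose, Matrix.fromBlocks_multiply,
        Matrix.fromBlocks_multiply, Matrix.fromBlocks_add]
      ext i j
      rcases i with i | i <;> rcases j with j | j <;> try simp
      fin_cases i <;> fin_cases j <;>
        simp [Matrix.mul_apply, Matrix.conjTranspose_apply, Fin.sum_univ_two]
    · simp [Matrix.trace, Fintype.sum_sum_type, Fin.sum_univ_two]⟩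

/-- The matrix `(0 0 v; -v* 0 ib; 0 0 0)`, for `v ∈ ℂ^(n-1)` and `b ∈ ℝ`. -/
def nilMat {m : ℕ} (v : Fin m → ℂ) (b : ℝ) : Mat m :=
  Matrix.fromBlocks 0 (Matrix.of fun i j => ![0, v i] j)
    (Matrix.of fun i j => ![-star (v j), 0] i) !![0, Complex.I * b; 0, 0]

theorem nilMat_mem {m : ℕ} (v : Fin m → ℂ) (b : ℝ) : nilMat v b ∈ su m := by
  refine ⟨?_, ?_⟩
  · rw [Q, nilMat, Matrix.fromBlocks_conjTranspose, Matrix.fromBlocks_multiply,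
      Matrix.fromBlocks_multiply, Matrix.fromBlocks_add]
    ext i j
    rcases i with i | i <;> rcases j with j | j
    · simp
    · fin_cases j <;> simp [Matrix.mul_apply, Matrix.conjTranspose_apply, Fin.sum_univ_two]
    · fin_cases i <;>
        simp only [Matrix.fromBlocks_apply₂₁, Matrix.add_apply, Matrix.mul_apply,
          Matrix.conjTranspose_apply, Fin.sum_univ_two, Matrix.of_apply] <;>
        simp [Matrix.one_apply]
    · fin_cases i <;> fin_cases j <;>
        simp [Matrix.mul_apply, Matrix.conjTranspose_apply, Fin.sum_univ_two]
  · simp [nilMat, Matrix.trace, Fintype.sum_sum_type, Fin.sum_univ_two]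

/-- The element `(0 0 v; -v* 0 ib; 0 0 0)` of the nilpotent part `𝔫` of the Iwasawa
decomposition. -/
def nil {m : ℕ} (v : Fin m → ℂ) (b : ℝ) : su m := ⟨nilMat v b, nilMat_mem v b⟩

/-- `N₂`, the generator of the centre `𝔫₂` of `𝔫`. -/
def N2 (m : ℕ) : su m := nil 0 1

/-- The nilpotent factor `N` of the Iwasawa decomposition of `SU(n, 1)`: the connected subgroup
with the Lie algebra `𝔫`, that is, the group generated by `exp 𝔫`. -/
def groupN (m : ℕ) : Subgroup (SU m) :=
  Subgroup.closure {g | ∃ (v : Fin m → ℂ) (b : ℝ), g = expSU (nil v b)}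

/-- The factor `A ≅ ℝ` of the Iwasawa decomposition: the group generated by the `exp (t A₀)`. -/
def groupA (m : ℕ) : Subgroup (SU m) :=
  Subgroup.closure {g | ∃ t : ℝ, g = expSU (t • A0 m)}

/-- The group `S(U(n-1)U(1))` of the matrices `diag (B, z, z)` of determinant `1` with
`B ∈ U(n-1)` and `|z| = 1`. -/
def groupM (m : ℕ) : Subgroup (SU m) where
  carrier := {g | ∃ B ∈ Matrix.unitaryGroup (Fin m) ℂ, ∃ z : ℂ, ‖z‖ = 1 ∧
    (g.1 : Mat m) = Matrix.fromBlocks B 0 0 !![z, 0; 0, z]}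
  one_mem' := ⟨1, one_mem _, 1, by simp, by
    rw [← Matrix.one_fin_two, Matrix.fromBlocks_one]; rfl⟩
  mul_mem' := by
    rintro g h ⟨B, hB, z, hz, hg⟩ ⟨C, hC, w, hw, hh⟩
    refine ⟨B * C, mul_mem hB hC, z * w, by rw [norm_mul, hz, hw, one_mul], ?_⟩
    rw [Subgroup.coe_mul, Matrix.SpecialLinearGroup.coe_mul, hg, hh, Matrix.fromBlocks_multiply]
    simp
  inv_mem' := by
    rintro g ⟨B, hB, z, hz, hg⟩
    refine ⟨star B, Unitary.star_mem hB, star z, by rw [norm_star, hz], ?_⟩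
    have h1 : ((g⁻¹ : SU m).1 : Mat m) * (g.1 : Mat m) = 1 := by
      rw [← Matrix.SpecialLinearGroup.coe_mul, ← Subgroup.coe_mul, inv_mul_cancel,
        Subgroup.coe_one, Matrix.SpecialLinearGroup.coe_one]
    have hzz : z * star z = 1 := by
      rw [Complex.star_def, Complex.mul_conj']; simp [hz]
    have h2 : (g.1 : Mat m) * Matrix.fromBlocks (star B) 0 0 !![star z, 0; 0, star z] = 1 := by
      rw [hg, Matrix.fromBlocks_multiply, Matrix.mem_unitaryGroup_iff.mp hB]
      simp only [Matrix.mul_zero, Matrix.zero_mul, add_zero, zero_add]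
      rw [← Matrix.fromBlocks_one]
      congr 1
      simp only [Matrix.mul_fin_two, hzz]
      simp [Matrix.one_fin_two]
    exact left_inv_eq_right_inv h1 h2

/-- The group `S(U(n-1)U(1))ℝ`, with `ℝ` the group `A`. -/
def groupMA (m : ℕ) : Subgroup (SU m) := groupM m ⊔ groupA m

/-- The data `F` of a non-symmetric homogeneous description: a connected closed subgroup of
`S(U(n-1)U(1))ℝ` whose projection to `ℝ` is not trivial, that is, which is not contained in
`S(U(n-1)U(1))`. -/
structure IsDescription {m : ℕ} (F : Subgroup (SU m)) : Prop where
  le : F ≤ groupMA m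
  connected : IsConnected (F : Set (SU m))
  closed : IsClosed (F : Set (SU m))
  proj : ¬ F ≤ groupM m

/-- The transitive group `G = F N` (the group `F` normalizes `N`, so that the subgroup that the
two generate is their product). -/
def groupG {m : ℕ} (F : Subgroup (SU m)) : Subgroup (SU m) := F ⊔ groupN m

/-- The isotropy group `H = F ∩ S(U(n-1)U(1))` of the base point. -/
def groupH {m : ℕ} (F : Subgroup (SU m)) : Subgroup (SU m) := F ⊓ groupM m

/-- `𝔪` is a reductive complement of the Lie algebra `𝔥` of `H` in the Lie algebra `𝔤` of `G`:
a subspace with `𝔤 = 𝔥 ⊕ 𝔪` and `Ad(H) 𝔪 ⊆ 𝔪`. -/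
structure IsReductiveComplement {m : ℕ} (G H : Subgroup (SU m)) (𝔪 : Submodule ℝ (su m)) :
    Prop where
  subset : ∀ X ∈ 𝔪, X ∈ lieAlg G
  span : ∀ X ∈ lieAlg G, ∃ Y ∈ lieAlg H, ∃ Z ∈ 𝔪, X = Y + Z
  disjoint : ∀ X ∈ lieAlg H, X ∈ 𝔪 → X = 0
  ad_mem : ∀ h ∈ H, ∀ X ∈ 𝔪, Ad h X ∈ 𝔪

/-- `k(E, E') = Re tr (E* E')`. -/
def innerK {m : ℕ} (X Y : su m) : ℝ := (Matrix.trace ((X : Mat m)ᴴ * (Y : Mat m))).re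

/-- `X` is the generator `A_r = A₀ + H_r` of the orthogonal complement of `𝔥` in `𝔣_r`, where
`𝔣_r` is the Lie algebra of `F` and `H_r ∈ 𝔰(𝔲(n-1) + 𝔲(1))`. -/
structure IsAr {m : ℕ} (F : Subgroup (SU m)) (X : su m) : Prop where
  mem : X ∈ lieAlg F
  sub_mem : X - A0 m ∈ lieAlg (groupM m)
  orthogonal : ∀ Y ∈ lieAlg (groupH F), innerK X Y = 0

/-! ## Vector fields and canonical connections -/

/-- Vector fields on `ℂH(n)` (with no regularity). -/
abbrev VField (m : ℕ) : Type := (p : CH m) → TangentSpace 𝓘(ℝ, Model m) p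

/-- The vector field `V` is smooth. -/
def IsSmooth {m : ℕ} (V : VField m) : Prop :=
  ContMDiff 𝓘(ℝ, Model m) 𝓘(ℝ, Model m).tangent ∞
    (fun p => (⟨p, V p⟩ : TangentBundle 𝓘(ℝ, Model m) (CH m)))

/-- The differential at `p` of the isometry `g`. -/
def dAct {m : ℕ} (g : SU m) (p : CH m) :
    TangentSpace 𝓘(ℝ, Model m) p →L[ℝ] TangentSpace 𝓘(ℝ, Model m) (g • p) :=
  mfderiv 𝓘(ℝ, Model m) 𝓘(ℝ, Model m) (fun q : CH m => g • q) p

/-- The infinitesimal generator of `X` on `ℂH(n)`, `p ↦ d/dt exp (t X) p` at `t = 0`. -/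
def fund {m : ℕ} (X : su m) : VField m := fun p =>
  (mfderiv 𝓘(ℝ, ℝ) 𝓘(ℝ, Model m) (fun t : ℝ => expSU (t • X) • p) 0 (1 : ℝ) : Model m)

/-- `V` is invariant under `G`. -/
def IsInvariantField {m : ℕ} (G : Subgroup (SU m)) (V : VField m) : Prop :=
  ∀ g ∈ G, ∀ p : CH m, dAct g p (V p) = V (g • p)

/-- `V` is the invariant vector field on `ℂH(n) = G/H` that is induced by `X ∈ 𝔪 ≅ T_o ℂH(n)`. -/
structure IsInducedBy {m : ℕ} (G : Subgroup (SU m)) (X : su m) (V : VField m) : Prop where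
  smooth : IsSmooth V
  invariant : IsInvariantField G V
  at_base : V (basePoint m) = fund X (basePoint m)

/-- Affine connections on `ℂH(n)`; `nabla V p v` is the derivative of the field `V` in the
direction of the tangent vector `v` at `p`. -/
abbrev Connection (m : ℕ) : Type :=
  CovariantDerivative 𝓘(ℝ, Model m) (Model m)
    (fun p : CH m => TangentSpace 𝓘(ℝ, Model m) p)

/-- The canonical connection of the reductive decomposition `𝔤 = 𝔥 + 𝔪`: the `G`-invariant affine
connection with `∇_B C = -[B, C]_𝔪` at the base point for `B, C ∈ 𝔪`, where elements of `𝔪` are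
regarded as infinitesimal generators. Invariance says that `∇_(dg v) V' = dg (∇_v V)` whenever
`V' = g_* V`. -/
structure IsCanonicalConnection {m : ℕ} (G H : Subgroup (SU m)) (𝔪 : Submodule ℝ (su m))
    (nabla : Connection m) : Prop where
  invariant : ∀ g ∈ G, ∀ V V' : VField m, IsSmooth V → IsSmooth V' →
    (∀ p, dAct g p (V p) = V' (g • p)) →
    ∀ (p : CH m) (v : TangentSpace 𝓘(ℝ, Model m) p),
      nabla V' (g • p) (dAct g p v) = dAct g p (nabla V p v)
  at_base : ∀ B ∈ 𝔪, ∀ C ∈ 𝔪, ∀ D ∈ 𝔪, bracket B C - D ∈ lieAlg H →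
    nabla (fund C) (basePoint m) (fund B (basePoint m)) = -fund D (basePoint m)

/-- `V` is parallel: `∇ V = 0`. -/
def IsParallel {m : ℕ} (nabla : Connection m) (V : VField m) : Prop :=
  ∀ (p : CH m) (v : TangentSpace 𝓘(ℝ, Model m) p), nabla V p v = 0

end ComplexHyperbolic

end

noncomputable section

namespace ComplexHyperbolic

open Filter Topology

/-! ## One-parameter groups as limits -/

/-! In the affine chart, `ℂH(n)` is the Siegel domain. The group `G = FN` fixes a null line at
infinity, the `cusp`. If `g` multiplies the cusp vector by `c`, then pairing with that vector shows
that `g` acts on the chart by an affine map. Its linear part multiplies the last coordinate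
direction by `|c|²`, and `height` is multiplied by the same `|c|²`. So `vertical κ`, that is
`height` times a constant vector `κ` in that direction, is invariant under the whole stabilizer of
the cusp (`isInvariantField_vertical`). The fields `U` and `V` are the cases `κ = -2` and `κ = i`.
They have no zeros and are independent because `height` is positive.

Since the connection and the fields are `G`-invariant and `G` is transitive, parallelism only has to
be checked at `o` (`isParallel_of_basePoint`). Every tangent vector there is `B*_o` for some `B ∈
𝔪`. If `C ∈ 𝔪` induces the field `V`, then `V - C*` vanishes at `o`, so its covariant derivative is
the ordinary derivative for any connection (`nabla_coordField_of_eq_zero`). That derivative along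
`B*` equals `[B, C]*_o` (`fderiv_vertical_sub_fderiv_vel`): conceptually `[B*, V] = 0` and `[B*, C*]
= -[B, C]*`. It cancels the defining value `-([B, C]_𝔪)*_o` of `∇_{B*} C*`, because elements of `𝔥`
vanish at `o`.

The remaining work is the existence of `A_r`. It needs an element of `𝔣` with non-zero
`A₀`-component, which is extracted from the global hypothesis that the connected closed group `F` is
not contained in `S(U(n-1)U(1))` (`IsDescription.exists_re_ne_zero`). The tool is the limit argument
behind Cartan's closed subgroup theorem: rescaled limits of group elements tending to `1` lie in the
Lie algebra (`exists_mem_lieAlg_of_tendsto`). -/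

theorem norm_pow_sub_pow_le {𝔸 : Type*} [NormedRing 𝔸] [NormOneClass 𝔸] {a b : 𝔸} {K : ℝ}
    (hK : 1 ≤ K) (ha : ‖a‖ ≤ K) (hb : ‖b‖ ≤ K) (n : ℕ) :
    ‖a ^ n - b ^ n‖ ≤ n * K ^ n * ‖a - b‖ := by
  induction n with
  | zero => simp
  | succ n ih =>
    have h : a ^ (n + 1) - b ^ (n + 1) = a ^ n * (a - b) + (a ^ n - b ^ n) * b := by
      rw [pow_succ, pow_succ]; noncomm_ring
    have hK0 : 0 ≤ K := zero_le_one.trans hK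
    have h1 : ‖a ^ n * (a - b)‖ ≤ K ^ (n + 1) * ‖a - b‖ := by
      refine (norm_mul_le _ _).trans ?_
      gcongr
      exact ((norm_pow_le _ _).trans (pow_le_pow_left₀ (norm_nonneg _) ha n)).trans
        (pow_le_pow_right₀ hK n.le_succ)
    have h2 : ‖(a ^ n - b ^ n) * b‖ ≤ n * K ^ (n + 1) * ‖a - b‖ := by
      refine (norm_mul_le _ _).trans ?_
      calc ‖a ^ n - b ^ n‖ * ‖b‖ ≤ (n * K ^ n * ‖a - b‖) * K := by gcongr
        _ = _ := by ring
    rw [h]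
    refine (norm_add_le _ _).trans ((add_le_add h1 h2).trans_eq ?_)
    push_cast
    ring

/-- Both `g k` and `exp (ε k • X)` are `1 + ε k • X + o(ε k)`, so they differ by `o(ε k)`. About `t
/ ε k` factors, with uniformly bounded powers, turn this into a difference `o(1)` of the powers. -/
theorem tendsto_pow_floor_exp {𝔸 : Type*} [NormedRing 𝔸] [NormedAlgebra ℝ 𝔸] [NormOneClass 𝔸]
    [CompleteSpace 𝔸] {g : ℕ → 𝔸} {ε : ℕ → ℝ} {X : 𝔸} (hε : ∀ k, 0 < ε k)
    (hε0 : Tendsto ε atTop (𝓝 0)) (hg : Tendsto (fun k => (ε k)⁻¹ • (g k - 1)) atTop (𝓝 X))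
    {t : ℝ} (ht : 0 ≤ t) :
    Tendsto (fun k => g k ^ ⌊t / ε k⌋₊) atTop (𝓝 (NormedSpace.exp (t • X))) := by
  let _ : NormedAlgebra ℚ 𝔸 := NormedAlgebra.restrictScalars ℚ ℝ 𝔸
  have hd := (hasDerivAt_exp_smul_const (𝕂 := ℝ) X 0)
  rw [zero_smul, NormedSpace.exp_zero, one_mul, hasDerivAt_iff_tendsto_slope] at hd
  have hεne : Tendsto ε atTop (𝓝[≠] 0) :=
    tendsto_nhdsWithin_iff.mpr ⟨hε0, Eventually.of_forall fun k => (hε k).ne'⟩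
  have he : Tendsto (fun k => (ε k)⁻¹ • (NormedSpace.exp (ε k • X) - 1)) atTop (𝓝 X) := by
    refine (hd.comp hεne).congr fun k => ?_
    simp [slope_def_module]
  obtain ⟨M, hM⟩ : ∃ M : ℝ, 0 ≤ M ∧ ∀ᶠ k in atTop, ‖(ε k)⁻¹ • (g k - 1)‖ ≤ M ∧
      ‖(ε k)⁻¹ • (NormedSpace.exp (ε k • X) - 1)‖ ≤ M := by
    refine ⟨‖X‖ + 1, by positivity, ?_⟩
    filter_upwards [hg.norm.eventually_le_const (lt_add_one ‖X‖),
      he.norm.eventually_le_const (lt_add_one ‖X‖)] with k h1 h2 using ⟨h1, h2⟩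
  -- The bound has exponential form so that its power `⌊t / ε k⌋₊` stays below `exp (t * M)`.
  have hbound : ∀ (k : ℕ) (a : 𝔸), ‖(ε k)⁻¹ • (a - 1)‖ ≤ M → ‖a‖ ≤ Real.exp (ε k * M) := by
    intro k a h
    have h1 : a = 1 + ε k • ((ε k)⁻¹ • (a - 1)) := by
      rw [smul_inv_smul₀ (hε k).ne']; abel
    calc ‖a‖ ≤ ‖(1 : 𝔸)‖ + ‖ε k • ((ε k)⁻¹ • (a - 1))‖ := by
          conv_lhs => rw [h1]
          exact norm_add_le _ _
      _ ≤ 1 + ε k * M := by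
          rw [norm_one, norm_smul, Real.norm_of_nonneg (hε k).le]
          gcongr
          exact (hε k).le
      _ ≤ _ := by rw [add_comm]; exact Real.add_one_le_exp _
  have hn : Tendsto (fun k => (⌊t / ε k⌋₊ : ℝ) * ε k) atTop (𝓝 t) := by
    refine tendsto_of_tendsto_of_tendsto_of_le_of_le (g := fun k => t - ε k) (h := fun _ => t)
      (by simpa using hε0.const_sub t) tendsto_const_nhds (fun k => ?_) (fun k => ?_)
    · have := Nat.lt_floor_add_one (t / ε k)
      rw [div_lt_iff₀ (hε k)] at this
      simp only
      nlinarith [hε k]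
    · have := Nat.floor_le (div_nonneg ht (hε k).le)
      rwa [le_div_iff₀ (hε k)] at this
  have hexp : Tendsto (fun k => NormedSpace.exp (ε k • X) ^ ⌊t / ε k⌋₊) atTop
      (𝓝 (NormedSpace.exp (t • X))) := by
    have hc : Continuous fun s : ℝ => NormedSpace.exp (s • X) :=
      NormedSpace.exp_continuous.comp (continuous_id.smul continuous_const)
    refine ((hc.tendsto t).comp hn).congr fun k => ?_
    simp only [Function.comp_apply]
    rw [← NormedSpace.exp_nsmul, mul_smul, Nat.cast_smul_eq_nsmul]
  have hdiff : Tendsto (fun k => g k ^ ⌊t / ε k⌋₊ - NormedSpace.exp (ε k • X) ^ ⌊t / ε k⌋₊) atTop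
      (𝓝 0) := by
    have hlim : Tendsto (fun k => t * Real.exp (t * M) *
        ‖(ε k)⁻¹ • (g k - 1) - (ε k)⁻¹ • (NormedSpace.exp (ε k • X) - 1)‖) atTop (𝓝 0) := by
      simpa using (hg.sub he).norm.const_mul (t * Real.exp (t * M))
    refine squeeze_zero_norm' ?_ hlim
    filter_upwards [hM.2] with k hk
    have hK : 1 ≤ Real.exp (ε k * M) := Real.one_le_exp (mul_nonneg (hε k).le hM.1)
    refine (norm_pow_sub_pow_le hK (hbound k _ hk.1) (hbound k _ hk.2) _).trans ?_
    have hle : (⌊t / ε k⌋₊ : ℝ) * ε k ≤ t := by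
      have := Nat.floor_le (div_nonneg ht (hε k).le)
      rwa [le_div_iff₀ (hε k)] at this
    have hs : g k - NormedSpace.exp (ε k • X) = ε k •
        ((ε k)⁻¹ • (g k - 1) - (ε k)⁻¹ • (NormedSpace.exp (ε k • X) - 1)) := by
      rw [← smul_sub, smul_inv_smul₀ (hε k).ne']; abel
    rw [hs, norm_smul, Real.norm_of_nonneg (hε k).le, ← Real.exp_nat_mul]
    calc _ = ((⌊t / ε k⌋₊ : ℝ) * ε k) * Real.exp ((⌊t / ε k⌋₊ : ℝ) * ε k * M) *
          ‖(ε k)⁻¹ • (g k - 1) - (ε k)⁻¹ • (NormedSpace.exp (ε k • X) - 1)‖ := by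
            rw [mul_assoc (⌊t / ε k⌋₊ : ℝ) (ε k) M]; ring
      _ ≤ _ := by
        gcongr
        exact hM.1
  simpa using hdiff.add hexp

theorem exp_smul_mem_of_tendsto {𝔸 : Type*} [NormedRing 𝔸] [NormedAlgebra ℝ 𝔸] [NormOneClass 𝔸]
    [CompleteSpace 𝔸] {S : Submonoid 𝔸} (hS : IsClosed (S : Set 𝔸)) {g : ℕ → 𝔸} {ε : ℕ → ℝ}
    {X : 𝔸} (hgS : ∀ k, g k ∈ S) (hε : ∀ k, 0 < ε k)
    (hε0 : Tendsto ε atTop (𝓝 0)) (hg : Tendsto (fun k => (ε k)⁻¹ • (g k - 1)) atTop (𝓝 X))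
    {t : ℝ} (ht : 0 ≤ t) : NormedSpace.exp (t • X) ∈ S :=
  hS.mem_of_tendsto (tendsto_pow_floor_exp hε hε0 hg ht)
    (Eventually.of_forall fun k => S.pow_mem (hgS k) _)

/-! ## Lie algebras of closed subgroups -/

/-- The inclusion of `SU(n, 1)` into the matrices. -/
def toMat (m : ℕ) : SU m →* Mat m where
  toFun g := (g.1 : Mat m)
  map_one' := rfl
  map_mul' _ _ := rfl

theorem toMat_apply {m : ℕ} (g : SU m) : toMat m g = (g.1 : Mat m) := rfl

theorem toMat_expSU {m : ℕ} (X : su m) : toMat m (expSU X) = NormedSpace.exp (X : Mat m) := rfl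

theorem toMat_injective (m : ℕ) : Function.Injective (toMat m) := fun _ _ h =>
  Subtype.ext (Subtype.ext h)

theorem toMat_mul_inv {m : ℕ} (g : SU m) : toMat m g * toMat m g⁻¹ = 1 := by
  rw [← map_mul, mul_inv_cancel, map_one]

theorem toMat_inv_mul {m : ℕ} (g : SU m) : toMat m g⁻¹ * toMat m g = 1 := by
  rw [← map_mul, inv_mul_cancel, map_one]

theorem toMat_preserves {m : ℕ} (g : SU m) : (toMat m g)ᴴ * Q m * toMat m g = Q m := g.2

theorem isClosedEmbedding_toMat (m : ℕ) : Topology.IsClosedEmbedding (toMat m) := by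
  refine Matrix.SpecialLinearGroup.isClosedEmbedding_val.comp
    (IsClosed.isClosedEmbedding_subtypeVal ?_)
  have hc : Continuous fun g : Matrix.SpecialLinearGroup (Idx m) ℂ => (g : Mat m) :=
    Matrix.SpecialLinearGroup.isClosedEmbedding_val.continuous
  exact isClosed_eq ((hc.matrix_conjTranspose.mul continuous_const).mul hc) continuous_const

theorem exp_add_smul {m : ℕ} (X : Mat m) (s t : ℝ) :
    NormedSpace.exp ((s + t) • X) = NormedSpace.exp (s • X) * NormedSpace.exp (t • X) := by
  rw [add_smul, Matrix.exp_add_of_commute]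
  exact ((Commute.refl X).smul_left s).smul_right t

theorem expSU_zero {m : ℕ} : expSU (0 : su m) = 1 := by
  apply toMat_injective
  rw [toMat_expSU, map_one]
  exact NormedSpace.exp_zero

open scoped Matrix.Norms.Operator in
theorem hasDerivAt_exp_smul_zero {m : ℕ} (X : Mat m) :
    HasDerivAt (fun t : ℝ => NormedSpace.exp (t • X)) X 0 := by
  have h := hasDerivAt_exp_smul_const (𝕂 := ℝ) X 0
  rwa [zero_smul, NormedSpace.exp_zero, one_mul] at h

open scoped Matrix.Norms.Operator in
theorem continuous_exp_smul {m : ℕ} :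
    Continuous fun p : ℝ × Mat m => NormedSpace.exp (p.1 • p.2) := by
  let _ : NormedAlgebra ℚ (Mat m) := NormedAlgebra.restrictScalars ℚ ℝ (Mat m)
  exact NormedSpace.exp_continuous.comp (continuous_fst.smul continuous_snd)

open scoped Matrix.Norms.Operator in
theorem commute_of_commute_exp {m : ℕ} {X J : Mat m}
    (h : ∀ t : ℝ, Commute (NormedSpace.exp (t • X)) J) : Commute X J := by
  have h1 : HasDerivAt (fun t : ℝ => NormedSpace.exp (t • X) * J) (X * J) 0 :=
    (hasDerivAt_exp_smul_zero X).mul_const J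
  have h2 : HasDerivAt (fun t : ℝ => J * NormedSpace.exp (t • X)) (J * X) 0 :=
    (hasDerivAt_exp_smul_zero X).const_mul J
  exact h1.unique (h2.congr_of_eventuallyEq (Filter.Eventually.of_forall fun t => h t))

open scoped Matrix.Norms.Operator in
theorem commute_exp {m : ℕ} {X J : Mat m} (h : Commute X J) : Commute (NormedSpace.exp X) J :=
  h.exp_left

open scoped Matrix.Norms.Operator in
-- Splitting off the scalar part `c • 1` leaves a traceless matrix, to which `det_exp_eq_one`
-- applies. Hence `det exp (tX) = exp (t tr X)`, and differentiating at `t = 0` gives the trace.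
theorem trace_eq_zero_of_det_exp {m : ℕ} {X : Mat m}
    (h : ∀ t : ℝ, (NormedSpace.exp (t • X)).det = 1) : X.trace = 0 := by
  set N : ℕ := Fintype.card (Idx m)
  have hN : (N : ℂ) ≠ 0 := Nat.cast_ne_zero.mpr Fintype.card_ne_zero
  set c : ℂ := X.trace / N with hc
  have hdet : ∀ t : ℝ, Complex.exp ((t : ℂ) * X.trace) = 1 := by
    intro t
    have h1 : (t • X) = ((t : ℂ) * c) • (1 : Mat m) + t • (X - c • (1 : Mat m)) := by
      rw [smul_sub, mul_smul, ← Complex.coe_smul t X, Complex.coe_smul t (c • (1 : Mat m)),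
        Complex.coe_smul]
      abel
    have h2 : (NormedSpace.exp (t • (X - c • (1 : Mat m)))).det = 1 := by
      refine det_exp_eq_one _ ?_
      rw [Matrix.trace_smul, Matrix.trace_sub, Matrix.trace_smul, Matrix.trace_one, hc,
        smul_eq_mul, div_mul_cancel₀ _ hN, sub_self, smul_zero]
    have h3 : NormedSpace.exp (((t : ℂ) * c) • (1 : Mat m))
        = Complex.exp ((t : ℂ) * c) • (1 : Mat m) := by
      rw [← Matrix.diagonal_one, ← Matrix.diagonal_smul, ← Matrix.diagonal_smul,
        Matrix.exp_diagonal]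
      congr 1
      funext i
      simp [Pi.coe_exp, Complex.exp_eq_exp_ℂ]
    have h4 := h t
    rw [h1, Matrix.exp_add_of_commute _ _ ((Commute.one_left _).smul_left _), Matrix.det_mul, h2,
      mul_one, h3, Matrix.det_smul, Matrix.det_one, mul_one, ← Complex.exp_nat_mul] at h4
    rw [← h4]
    congr 1
    rw [hc]
    field_simp
    rfl
  have h1 : HasDerivAt (fun t : ℝ => Complex.exp ((t : ℂ) * X.trace)) (X.trace) 0 := by
    have h2 : HasDerivAt (fun z : ℂ => Complex.exp (z * X.trace)) X.trace ((0 : ℝ) : ℂ) := by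
      simpa using ((hasDerivAt_id (((0 : ℝ) : ℂ))).mul_const X.trace).cexp
    exact h2.comp_ofReal
  exact (h1.congr_of_eventuallyEq (Filter.Eventually.of_forall fun t => (hdet t).symm)).unique
    (hasDerivAt_const (0 : ℝ) (1 : ℂ))

open scoped Matrix.Norms.Operator in
theorem mem_su_of_exp {m : ℕ} {X : Mat m}
    (h : ∀ t : ℝ, ∃ g : SU m, toMat m g = NormedSpace.exp (t • X)) : X ∈ su m := by
  refine ⟨?_, trace_eq_zero_of_det_exp fun t => ?_⟩
  · have h1 : HasDerivAt (fun t : ℝ => NormedSpace.exp (t • Xᴴ) * Q m * NormedSpace.exp (t • X))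
        (Xᴴ * Q m + Q m * X) 0 := by
      have := ((hasDerivAt_exp_smul_zero Xᴴ).mul_const (Q m)).mul (hasDerivAt_exp_smul_zero X)
      simp only [zero_smul, NormedSpace.exp_zero, one_mul, mul_one] at this
      exact this
    refine h1.unique ((hasDerivAt_const (0 : ℝ) (Q m)).congr_of_eventuallyEq
      (Filter.Eventually.of_forall fun t => ?_))
    obtain ⟨g, hg⟩ := h t
    have h2 := toMat_preserves g
    rw [hg, ← Matrix.exp_conjTranspose, Matrix.conjTranspose_smul, star_trivial] at h2
    exact h2
  · obtain ⟨g, hg⟩ := h t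
    rw [← hg]
    exact g.1.2

open scoped Matrix.Norms.Operator in
-- The key step of the closed subgroup theorem. The limit is a priori only a matrix; it lies in
-- `su(n, 1)` because its whole one-parameter group lies in `G`.
theorem exists_mem_lieAlg_of_tendsto {m : ℕ} {G : Subgroup (SU m)}
    (hG : IsClosed (G : Set (SU m))) {g : ℕ → SU m} {ε : ℕ → ℝ} {X : Mat m} (hgG : ∀ k, g k ∈ G)
    (hε : ∀ k, 0 < ε k) (hε0 : Tendsto ε atTop (𝓝 0))
    (hg : Tendsto (fun k => (ε k)⁻¹ • (toMat m (g k) - 1)) atTop (𝓝 X)) :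
    ∃ Y ∈ lieAlg G, (Y : Mat m) = X := by
  have hS : IsClosed ((G.toSubmonoid.map (toMat m) : Submonoid (Mat m)) : Set (Mat m)) :=
    (isClosedEmbedding_toMat m).isClosedMap _ hG
  have h1 : ∀ t : ℝ, 0 ≤ t → ∃ a ∈ G, toMat m a = NormedSpace.exp (t • X) := fun t ht => by
    obtain ⟨a, ha, hX⟩ := exp_smul_mem_of_tendsto hS
      (fun k => ⟨g k, hgG k, rfl⟩) hε hε0 hg ht
    exact ⟨a, ha, hX⟩
  -- The image of `G` was used only as a submonoid, which covers `t ≥ 0`; inverses in `G` give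
  -- negative `t`.
  have h2 : ∀ t : ℝ, ∃ a ∈ G, toMat m a = NormedSpace.exp (t • X) := fun t => by
    rcases le_total 0 t with ht | ht
    · exact h1 t ht
    · obtain ⟨a, ha, hX⟩ := h1 (-t) (by linarith)
      refine ⟨a⁻¹, G.inv_mem ha, ?_⟩
      refine left_inv_eq_right_inv (toMat_inv_mul a) ?_
      rw [hX, ← exp_add_smul, neg_add_cancel, zero_smul, NormedSpace.exp_zero]
  refine ⟨⟨X, mem_su_of_exp fun t => ?_⟩, fun t => ?_, rfl⟩
  · obtain ⟨a, -, ha⟩ := h2 t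
    exact ⟨a, ha⟩
  · obtain ⟨a, ha, hX⟩ := h2 t
    have : expSU (t • (⟨X, mem_su_of_exp fun t => ⟨_, (h2 t).choose_spec.2⟩⟩ : su m)) = a :=
      toMat_injective m hX.symm
    rw [this]
    exact ha

theorem smul_mem_lieAlg {m : ℕ} {G : Subgroup (SU m)} {X : su m} (hX : X ∈ lieAlg G) (c : ℝ) :
    c • X ∈ lieAlg G := fun t => by
  rw [smul_smul]
  exact hX _

theorem zero_mem_lieAlg {m : ℕ} (G : Subgroup (SU m)) : (0 : su m) ∈ lieAlg G := fun t => by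
  rw [smul_zero, expSU_zero]
  exact G.one_mem

theorem lieAlg_mono {m : ℕ} {G G' : Subgroup (SU m)} (h : G ≤ G') : lieAlg G ⊆ lieAlg G' :=
  fun _ hX t => h (hX t)

theorem mem_lieAlg_inf {m : ℕ} {G G' : Subgroup (SU m)} {X : su m} :
    X ∈ lieAlg (G ⊓ G') ↔ X ∈ lieAlg G ∧ X ∈ lieAlg G' :=
  ⟨fun h => ⟨fun t => (h t).1, fun t => (h t).2⟩, fun h t => ⟨h.1 t, h.2 t⟩⟩

open scoped Matrix.Norms.Operator in
theorem tendsto_slope_of_hasDerivAt {m : ℕ} {f : ℝ → Mat m} {X : Mat m} (hf : HasDerivAt f X 0) :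
    Tendsto (fun k : ℕ => ((1 / ((k : ℝ) + 1)))⁻¹ • (f (1 / ((k : ℝ) + 1)) - f 0)) atTop (𝓝 X) := by
  have hf := (hasDerivAt_iff_tendsto_slope (𝕜 := ℝ) (F := Mat m)).mp hf
  have : Tendsto (fun k : ℕ => 1 / ((k : ℝ) + 1)) atTop (𝓝[≠] 0) :=
    tendsto_nhdsWithin_iff.mpr ⟨tendsto_one_div_add_atTop_nhds_zero_nat,
      Eventually.of_forall fun k => by
        simp only [Set.mem_compl_iff, Set.mem_singleton_iff]
        positivity⟩
  refine (hf.comp this).congr fun k => ?_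
  simp [slope_def_module]

open scoped Matrix.Norms.Operator in
theorem exists_mem_lieAlg_of_hasDerivAt {m : ℕ} {G : Subgroup (SU m)}
    (hG : IsClosed (G : Set (SU m))) {g : ℝ → SU m} {X : Mat m} (hgG : ∀ t, g t ∈ G)
    (h0 : g 0 = 1) (hg : HasDerivAt (fun t => toMat m (g t)) X 0) :
    ∃ Y ∈ lieAlg G, (Y : Mat m) = X := by
  refine exists_mem_lieAlg_of_tendsto hG (g := fun k => g (1 / ((k : ℝ) + 1)))
    (fun k => hgG _) (fun k => by positivity)
    tendsto_one_div_add_atTop_nhds_zero_nat ((tendsto_slope_of_hasDerivAt hg).congr fun k => ?_)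
  rw [h0, map_one]

open scoped Matrix.Norms.Operator in
theorem add_mem_lieAlg {m : ℕ} {G : Subgroup (SU m)} (hG : IsClosed (G : Set (SU m)))
    {X Y : su m} (hX : X ∈ lieAlg G) (hY : Y ∈ lieAlg G) : X + Y ∈ lieAlg G := by
  obtain ⟨Z, hZ, hZe⟩ := exists_mem_lieAlg_of_hasDerivAt hG
    (g := fun t => expSU (t • X) * expSU (t • Y)) (X := (X : Mat m) + Y)
    (fun t => G.mul_mem (hX t) (hY t)) (by simp [expSU_zero]) (by
      have := (hasDerivAt_exp_smul_zero (X : Mat m)).mul (hasDerivAt_exp_smul_zero (Y : Mat m))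
      simp only [zero_smul, NormedSpace.exp_zero, one_mul, mul_one] at this
      exact this)
  have : Z = X + Y := Subtype.ext hZe
  rwa [← this]

/-- The Lie algebra of a closed subgroup is a linear subspace. -/
def lieSubmodule {m : ℕ} (G : Subgroup (SU m)) (hG : IsClosed (G : Set (SU m))) :
    Submodule ℝ (su m) where
  carrier := lieAlg G
  add_mem' := add_mem_lieAlg hG
  zero_mem' := zero_mem_lieAlg G
  smul_mem' c _ hX := smul_mem_lieAlg hX c

theorem mem_lieSubmodule {m : ℕ} {G : Subgroup (SU m)} {hG : IsClosed (G : Set (SU m))}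
    {X : su m} : X ∈ lieSubmodule G hG ↔ X ∈ lieAlg G := Iff.rfl

theorem conj_mem_lieAlg {m : ℕ} {G : Subgroup (SU m)} {g : SU m} (hg : g ∈ G) {X : su m}
    (hX : X ∈ lieAlg G) : Ad g X ∈ lieAlg G := fun t => by
  have : expSU (t • Ad g X) = g * expSU (t • X) * g⁻¹ := by
    apply toMat_injective
    have hu : IsUnit (toMat m g) := IsUnit.of_mul_eq_one _ (toMat_mul_inv g)
    have hi : (toMat m g)⁻¹ = toMat m g⁻¹ := Matrix.inv_eq_left_inv (toMat_inv_mul g)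
    rw [map_mul, map_mul, toMat_expSU, toMat_expSU, ← hi, ← Matrix.exp_conj _ _ hu, hi]
    congr 1
    change t • (toMat m g * (X : Mat m) * toMat m g⁻¹) = toMat m g * (t • (X : Mat m)) * _
    rw [mul_smul_comm, smul_mul_assoc]
  rw [this]
  exact G.mul_mem (G.mul_mem hg (hX t)) (G.inv_mem hg)

open scoped Matrix.Norms.Operator in
-- The bracket is the derivative at `0` of `t ↦ Ad (exp tX) Y`. The difference quotients lie in a
-- finite-dimensional, hence closed, subspace.
theorem bracket_mem_lieAlg {m : ℕ} {G : Subgroup (SU m)} (hG : IsClosed (G : Set (SU m)))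
    {X Y : su m} (hX : X ∈ lieAlg G) (hY : Y ∈ lieAlg G) : bracket X Y ∈ lieAlg G := by
  have hcl : IsClosed ((lieSubmodule G hG : Submodule ℝ (su m)) : Set (su m)) :=
    Submodule.closed_of_finiteDimensional _
  have hd : HasDerivAt (fun t : ℝ => NormedSpace.exp (t • (X : Mat m)) * (Y : Mat m) *
      NormedSpace.exp (t • (-(X : Mat m)))) ((X : Mat m) * Y - Y * X) 0 := by
    have := ((hasDerivAt_exp_smul_zero (X : Mat m)).mul_const (Y : Mat m)).mul
      (hasDerivAt_exp_smul_zero (-(X : Mat m)))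
    simp only [zero_smul, NormedSpace.exp_zero, one_mul, mul_one, mul_neg,
      ← sub_eq_add_neg] at this
    simp only [smul_neg] at this ⊢
    exact this
  have hA : ∀ t : ℝ, ((Ad (expSU (t • X)) Y : su m) : Mat m)
      = NormedSpace.exp (t • (X : Mat m)) * (Y : Mat m) * NormedSpace.exp (t • (-(X : Mat m))) := by
    intro t
    have : toMat m (expSU (t • X))⁻¹ = NormedSpace.exp (t • (-(X : Mat m))) := by
      refine left_inv_eq_right_inv (toMat_inv_mul _) ?_
      rw [toMat_expSU, smul_neg, ← neg_smul]
      change NormedSpace.exp (t • (X : Mat m)) * _ = 1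
      rw [← exp_add_smul, add_neg_cancel, zero_smul, NormedSpace.exp_zero]
    rw [← this]
    rfl
  have ht := tendsto_slope_of_hasDerivAt hd
  have ht' : Tendsto (fun k : ℕ => ((1 / ((k : ℝ) + 1)))⁻¹ •
      (Ad (expSU ((1 / ((k : ℝ) + 1)) • X)) Y - Y)) atTop (𝓝 (bracket X Y)) := by
    rw [tendsto_subtype_rng]
    refine ht.congr fun k => ?_
    rw [← hA]
    simp
  refine hcl.mem_of_tendsto ht' (Eventually.of_forall fun k => ?_)
  exact Submodule.smul_mem _ _ (Submodule.sub_mem _ (conj_mem_lieAlg (hX _) hY) hY)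

/-! ## The groups `S(U(n-1)U(1))` and `S(U(n-1)U(1))A` as centralizers -/

/-- The matrix that exchanges the last two coordinates and annihilates the others. -/
def swapMat (m : ℕ) : Mat m := Matrix.fromBlocks 0 0 0 !![0, 1; 1, 0]

/-- The eigenvalues `0`, `1`, `-1` of `A₀` are distinct, so its commutant consists of the matrices
that preserve the three eigenspaces. -/
theorem commute_A0_iff {m : ℕ} {A : Mat m} : Commute A (A0 m : Mat m) ↔
    ∃ (B : Matrix (Fin m) (Fin m) ℂ) (a d : ℂ), A = Matrix.fromBlocks B 0 0 !![a, 0; 0, d] := by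
  constructor
  · intro h
    have h' : ∀ i j, (A * (A0 m : Mat m)) i j = ((A0 m : Mat m) * A) i j := fun i j => by rw [h.eq]
    simp only [A0, Matrix.mul_apply, Fintype.sum_sum_type, Fin.sum_univ_two] at h'
    have h12 : ∀ i j, A (.inl i) (.inr j) = 0 := fun i j => by
      have := h' (.inl i) (.inr j)
      fin_cases j <;> simpa using this
    have h21 : ∀ i j, A (.inr i) (.inl j) = 0 := fun i j => by
      have := h' (.inr i) (.inl j)
      fin_cases i <;> simpa [eq_comm] using this
    have h01 : A (.inr 0) (.inr 1) = 0 := by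
      have := h' (.inr 0) (.inr 1)
      simp at this
      linear_combination -(1 / 2 : ℂ) * this
    have h10 : A (.inr 1) (.inr 0) = 0 := by
      have := h' (.inr 1) (.inr 0)
      simp at this
      linear_combination (1 / 2 : ℂ) * this
    refine ⟨A.toBlocks₁₁, A (.inr 0) (.inr 0), A (.inr 1) (.inr 1), ?_⟩
    ext i j
    rcases i with i | i <;> rcases j with j | j
    · rfl
    · simp [h12]
    · simp [h21]
    · fin_cases i <;> fin_cases j <;> simp [h01, h10]
  · rintro ⟨B, a, d, rfl⟩
    simp [Commute, SemiconjBy, A0, Matrix.fromBlocks_multiply]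

theorem commute_swapMat_iff {m : ℕ} {B : Matrix (Fin m) (Fin m) ℂ} {a d : ℂ} :
    Commute (Matrix.fromBlocks B 0 0 !![a, 0; 0, d]) (swapMat m) ↔ a = d := by
  constructor
  · intro h
    have := congrFun (congrFun h.eq (.inr 0)) (.inr 1)
    simpa [swapMat, Matrix.fromBlocks_multiply] using this
  · rintro rfl
    simp [Commute, SemiconjBy, swapMat, Matrix.fromBlocks_multiply]

theorem preserves_fromBlocks {m : ℕ} {B : Matrix (Fin m) (Fin m) ℂ} {a d : ℂ} {g : SU m}
    (h : toMat m g = Matrix.fromBlocks B 0 0 !![a, 0; 0, d]) :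
    B ∈ Matrix.unitaryGroup (Fin m) ℂ ∧ star a * d = 1 := by
  have h1 := toMat_preserves g
  rw [h, Q, Matrix.fromBlocks_conjTranspose, Matrix.fromBlocks_multiply,
    Matrix.fromBlocks_multiply, Matrix.fromBlocks_inj] at h1
  obtain ⟨h2, -, -, h3⟩ := h1
  constructor
  · rw [Matrix.mem_unitaryGroup_iff']
    simpa [Matrix.star_eq_conjTranspose] using h2
  · have := congrFun (congrFun h3 0) 1
    simpa [Matrix.mul_apply, Fin.sum_univ_two] using this

/-- Commuting with `A₀` gives the block shape, commuting with the swap equates the last two entries,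
and the form supplies unitarity and modulus one. As a centralizer, the group is visibly closed and
its Lie algebra is given by linear equations. -/
theorem mem_groupM_iff {m : ℕ} {g : SU m} : g ∈ groupM m ↔
    Commute (toMat m g) (A0 m : Mat m) ∧ Commute (toMat m g) (swapMat m) := by
  constructor
  · rintro ⟨B, -, z, -, h⟩
    have h' : toMat m g = Matrix.fromBlocks B 0 0 !![z, 0; 0, z] := h
    exact ⟨commute_A0_iff.mpr ⟨B, z, z, h'⟩, by rw [h', commute_swapMat_iff]⟩
  · rintro ⟨h1, h2⟩
    obtain ⟨B, a, d, h⟩ := commute_A0_iff.mp h1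
    rw [h, commute_swapMat_iff] at h2
    obtain ⟨hB, hz⟩ := preserves_fromBlocks h
    subst h2
    refine ⟨B, hB, a, ?_, h⟩
    have : ‖a‖ * ‖a‖ = 1 := by simpa using congrArg norm hz
    nlinarith [norm_nonneg a]

theorem mem_lieAlg_groupM_iff {m : ℕ} {X : su m} : X ∈ lieAlg (groupM m) ↔
    Commute (X : Mat m) (A0 m : Mat m) ∧ Commute (X : Mat m) (swapMat m) :=
  ⟨fun h => ⟨commute_of_commute_exp fun t => (mem_groupM_iff.mp (h t)).1,
      commute_of_commute_exp fun t => (mem_groupM_iff.mp (h t)).2⟩,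
    fun h t => mem_groupM_iff.mpr ⟨commute_exp (h.1.smul_left t), commute_exp (h.2.smul_left t)⟩⟩

theorem commute_of_mem_groupMA {m : ℕ} {g : SU m} (hg : g ∈ groupMA m) :
    Commute (toMat m g) (A0 m : Mat m) := by
  let C : Subgroup (SU m) :=
    { carrier := {g | Commute (toMat m g) (A0 m : Mat m)}
      one_mem' := by simp
      mul_mem' := fun {a b} ha hb => by
        simp only [Set.mem_ofPred_eq, map_mul] at *
        exact ha.mul_left hb
      inv_mem' := fun {a} (ha : Commute _ _) => by
        change toMat m a⁻¹ * (A0 m : Mat m) = (A0 m : Mat m) * toMat m a⁻¹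
        calc _ = toMat m a⁻¹ * ((A0 m : Mat m) * toMat m a) * toMat m a⁻¹ := by
              rw [Matrix.mul_assoc, Matrix.mul_assoc, toMat_mul_inv, Matrix.mul_one]
          _ = _ := by rw [← ha.eq, ← Matrix.mul_assoc, toMat_inv_mul, Matrix.one_mul] }
  have hle : groupMA m ≤ C := by
    refine sup_le (fun g hg => (mem_groupM_iff.mp hg).1) ((Subgroup.closure_le _).mpr ?_)
    rintro _ ⟨t, rfl⟩
    exact commute_exp ((Commute.refl (A0 m : Mat m)).smul_left t)
  exact hle hg

theorem isClosed_groupM (m : ℕ) : IsClosed (groupM m : Set (SU m)) := by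
  have hc : Continuous (toMat m) := (isClosedEmbedding_toMat m).continuous
  have : (groupM m : Set (SU m)) = {g | toMat m g * (A0 m : Mat m) = (A0 m : Mat m) * toMat m g} ∩
      {g | toMat m g * swapMat m = swapMat m * toMat m g} := by
    ext g
    exact mem_groupM_iff
  rw [this]
  exact (isClosed_eq (hc.mul continuous_const) (continuous_const.mul hc)).inter
    (isClosed_eq (hc.mul continuous_const) (continuous_const.mul hc))

theorem isClosed_groupH {m : ℕ} {F : Subgroup (SU m)} (hF : IsClosed (F : Set (SU m))) :
    IsClosed (groupH F : Set (SU m)) := hF.inter (isClosed_groupM m)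

theorem fromBlocks_mem_su {m : ℕ} {B : Matrix (Fin m) (Fin m) ℂ} {a d : ℂ} {X : su m}
    (h : (X : Mat m) = Matrix.fromBlocks B 0 0 !![a, 0; 0, d]) : star a + d = 0 := by
  have h1 := X.2.1
  rw [h, Q, Matrix.fromBlocks_conjTranspose, Matrix.fromBlocks_multiply,
    Matrix.fromBlocks_multiply, Matrix.fromBlocks_add] at h1
  have := congrFun (congrFun h1 (.inr 0)) (.inr 1)
  simpa [Matrix.mul_apply, Fin.sum_univ_two] using this

/-- With last diagonal entries `a`, `d`, the form forces `d = -conj a`, so `a = d` exactly when `Re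
a = 0`. Thus `Re a` measures the `A₀`-component. -/
theorem mem_lieAlg_groupM_of_commute {m : ℕ} {X : su m} (h : Commute (X : Mat m) (A0 m : Mat m))
    (h0 : ((X : Mat m) (.inr 0) (.inr 0)).re = 0) : X ∈ lieAlg (groupM m) := by
  refine mem_lieAlg_groupM_iff.mpr ⟨h, ?_⟩
  obtain ⟨B, a, d, hX⟩ := commute_A0_iff.mp h
  rw [hX, commute_swapMat_iff]
  have h1 := fromBlocks_mem_su hX
  have h2 : a.re = 0 := by simpa [hX] using h0
  apply Complex.ext
  · have := congrArg Complex.re h1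
    simp at this
    linarith
  · have := congrArg Complex.im h1
    simp at this
    linarith

/-! ## The non-compact direction of `𝔣` -/

/-- The modulus of the eigenvalue of `g` on the next-to-last coordinate vector. -/
def dilation {m : ℕ} (g : SU m) : ℝ := ‖toMat m g (.inr 0) (.inr 0)‖

theorem continuous_dilation (m : ℕ) : Continuous (dilation (m := m)) :=
  ((isClosedEmbedding_toMat m).continuous.matrix_elem _ _).norm

theorem dilation_mul {m : ℕ} {g h : SU m} (hg : Commute (toMat m g) (A0 m : Mat m))
    (hh : Commute (toMat m h) (A0 m : Mat m)) : dilation (g * h) = dilation g * dilation h := by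
  obtain ⟨B, a, d, hg'⟩ := commute_A0_iff.mp hg
  obtain ⟨C, b, e, hh'⟩ := commute_A0_iff.mp hh
  rw [dilation, dilation, dilation, map_mul, hg', hh', Matrix.fromBlocks_multiply]
  simp

/-- `dilation` is the projection to `A ≅ ℝ` in multiplicative form, and this identifies its kernel.
-/
theorem mem_groupM_iff_dilation {m : ℕ} {g : SU m} (hg : Commute (toMat m g) (A0 m : Mat m)) :
    g ∈ groupM m ↔ dilation g = 1 := by
  obtain ⟨B, a, d, hg'⟩ := commute_A0_iff.mp hg
  have hd : dilation g = ‖a‖ := by simp [dilation, hg']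
  have had := (preserves_fromBlocks hg').2
  rw [mem_groupM_iff, hg', commute_swapMat_iff, hd]
  constructor
  · rintro ⟨-, rfl⟩
    have : ‖a‖ * ‖a‖ = 1 := by simpa using congrArg norm had
    nlinarith [norm_nonneg a]
  · intro h
    refine ⟨hg' ▸ hg, ?_⟩
    have h1 : a * star a = 1 := by
      rw [Complex.star_def, Complex.mul_conj', h]; simp
    exact left_inv_eq_right_inv h1 had

/-- The only unbounded direction is the dilation: the upper block is unitary, and the last two
entries have moduli `r` and `1 / r`. -/
theorem isCompact_dilation {m : ℕ} {F : Subgroup (SU m)} (hF : IsClosed (F : Set (SU m)))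
    (hle : F ≤ groupMA m) (c : ℝ) :
    IsCompact {g : SU m | g ∈ F ∧ 1 ≤ dilation g ∧ dilation g ≤ c} := by
  have hK : IsCompact (Set.pi Set.univ fun _ => Set.pi Set.univ fun _ =>
      Metric.closedBall 0 (max c 1) : Set (Mat m)) :=
    isCompact_univ_pi fun _ => isCompact_univ_pi fun _ => isCompact_closedBall _ _
  refine ((isClosedEmbedding_toMat m).isCompact_preimage hK).of_isClosed_subset ?_ ?_
  · exact hF.inter ((isClosed_le continuous_const (continuous_dilation m)).inter
      (isClosed_le (continuous_dilation m) continuous_const))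
  · rintro g ⟨hg, h1, h2⟩ i - j -
    obtain ⟨B, a, d, hg'⟩ := commute_A0_iff.mp (commute_of_mem_groupMA (hle hg))
    have hd : dilation g = ‖a‖ := by simp [dilation, hg']
    obtain ⟨hB, had⟩ := preserves_fromBlocks hg'
    have hn : ‖a‖ * ‖d‖ = 1 := by simpa using congrArg norm had
    rw [mem_closedBall_zero_iff, hg']
    rcases i with i | i <;> rcases j with j | j
    · exact (entry_norm_bound_of_unitary hB i j).trans (le_max_right _ _)
    · simp
    · simp
    · have h3 : ‖d‖ ≤ 1 := by
        rw [hd] at h1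
        nlinarith [norm_nonneg d]
      fin_cases i <;> fin_cases j <;> simp
      · exact Or.inl (hd ▸ h2)
      · exact Or.inr h3

theorem IsDescription.commute {m : ℕ} {F : Subgroup (SU m)} (hF : IsDescription F) {g : SU m}
    (hg : g ∈ F) : Commute (toMat m g) (A0 m : Mat m) := commute_of_mem_groupMA (hF.le hg)

theorem IsDescription.commute_lieAlg {m : ℕ} {F : Subgroup (SU m)} (hF : IsDescription F)
    {X : su m} (hX : X ∈ lieAlg F) : Commute (X : Mat m) (A0 m : Mat m) :=
  commute_of_commute_exp fun t => hF.commute (hX t)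

/-- This is where connectedness of `F` enters: the image of `dilation` contains `1` and some value
above `1`, hence the interval between them. -/
theorem IsDescription.exists_dilation {m : ℕ} {F : Subgroup (SU m)} (hF : IsDescription F) :
    ∃ c : ℝ, 1 < c ∧ ∀ r : ℝ, 1 ≤ r → r ≤ c → ∃ g ∈ F, dilation g = r := by
  have h1 : dilation (1 : SU m) = 1 := by simp [dilation]
  obtain ⟨g, hg, hgM⟩ := SetLike.not_le_iff_exists.mp hF.proj
  have hg1 : dilation g ≠ 1 := fun h => hgM ((mem_groupM_iff_dilation (hF.commute hg)).mpr h)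
  obtain ⟨c, hc, a, ha, hac⟩ : ∃ c : ℝ, 1 < c ∧ ∃ a ∈ F, dilation a = c := by
    rcases lt_or_gt_of_ne hg1 with h | h
    · refine ⟨_, ?_, g⁻¹, F.inv_mem hg, rfl⟩
      have h2 := dilation_mul (hF.commute hg) (hF.commute (F.inv_mem hg))
      rw [mul_inv_cancel, h1] at h2
      have : 0 ≤ dilation g := norm_nonneg _
      by_contra! h3
      have : 0 ≤ dilation g⁻¹ := norm_nonneg _
      nlinarith
    · exact ⟨_, h, g, hg, rfl⟩
  have hsub := (hF.connected.isPreconnected.image dilation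
    (continuous_dilation m).continuousOn).Icc_subset ⟨1, F.one_mem, h1⟩ ⟨a, ha, hac⟩
  refine ⟨c, hc, fun r hr hrc => ?_⟩
  obtain ⟨b, hb, hbr⟩ := hsub ⟨hr, hrc⟩
  exact ⟨b, hb, hbr⟩

open scoped Matrix.Norms.Operator in
theorem exists_nearest_mul {m : ℕ} {H : Subgroup (SU m)} (hH : IsCompact (H : Set (SU m)))
    (g : SU m) : ∃ a ∈ H, ∀ h ∈ H, ‖toMat m (g * a) - 1‖ ≤ ‖toMat m (g * a * h) - 1‖ := by
  have hc : Continuous fun h : SU m => ‖toMat m (g * h) - 1‖ := by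
    simp only [map_mul]
    exact ((continuous_const.mul (isClosedEmbedding_toMat m).continuous).sub continuous_const).norm
  obtain ⟨a, ha, hmin⟩ := hH.exists_isMinOn ⟨1, H.one_mem⟩ hc.continuousOn
  refine ⟨a, ha, fun h hh => ?_⟩
  rw [mul_assoc]
  exact hmin (H.mul_mem ha hh)

open scoped Matrix.Norms.Operator in
theorem tendsto_smul_mul_exp_sub_one {m : ℕ} {A : ℕ → Mat m} {ε : ℕ → ℝ} {X : Mat m}
    (hε : ∀ k, 0 < ε k) (hε0 : Tendsto ε atTop (𝓝 0))
    (hA : Tendsto (fun k => (ε k)⁻¹ • (A k - 1)) atTop (𝓝 X)) :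
    Tendsto (fun k => (ε k)⁻¹ • (A k * NormedSpace.exp (ε k • -X) - 1)) atTop (𝓝 0) := by
  have hε' : Tendsto ε atTop (𝓝[≠] 0) :=
    tendsto_nhdsWithin_iff.mpr ⟨hε0, Eventually.of_forall fun k => (hε k).ne'⟩
  have h1 := ((hasDerivAt_iff_tendsto_slope (𝕜 := ℝ) (F := Mat m)).mp
    (hasDerivAt_exp_smul_zero (-X))).comp hε'
  have h2 : Tendsto (fun k => NormedSpace.exp (ε k • -X)) atTop (𝓝 1) := by
    have := (continuous_exp_smul (m := m)).tendsto (0, -X)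
    rw [zero_smul, NormedSpace.exp_zero] at this
    exact this.comp (hε0.prodMk_nhds tendsto_const_nhds)
  have h3 := (hA.mul h2).add h1
  rw [mul_one, add_neg_cancel] at h3
  refine h3.congr fun k => ?_
  simp only [Function.comp_apply, slope_def_module, zero_smul, NormedSpace.exp_zero, sub_zero]
  rw [smul_mul_assoc, ← smul_add]
  congr 1
  noncomm_ring

open scoped Matrix.Norms.Operator in
-- Otherwise `𝔣 = 𝔥`. Elements of `F` outside `H` whose dilations tend to `1`, chosen nearest to `1`
-- in their cosets modulo the compact group `H`, converge to `1`. A limit of their normalized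
-- differences from `1` lies in `𝔣 = 𝔥`, so moving along `H` in the opposite direction brings them
-- strictly nearer, a contradiction.
theorem IsDescription.exists_re_ne_zero {m : ℕ} {F : Subgroup (SU m)} (hF : IsDescription F) :
    ∃ X ∈ lieAlg F, ((X : Mat m) (.inr 0) (.inr 0)).re ≠ 0 := by
  by_contra! hcon
  have hH : ∀ X ∈ lieAlg F, X ∈ lieAlg (groupH F) := fun X hX =>
    mem_lieAlg_inf.mpr ⟨hX, mem_lieAlg_groupM_of_commute (hF.commute_lieAlg hX) (hcon X hX)⟩
  have hHc : IsCompact (groupH F : Set (SU m)) := by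
    refine (isCompact_dilation hF.closed hF.le 1).of_isClosed_subset (isClosed_groupH hF.closed) ?_
    rintro g ⟨hg, hgM⟩
    have := (mem_groupM_iff_dilation (hF.commute hg)).mp hgM
    exact ⟨hg, this.ge, this.le⟩
  obtain ⟨c, hc, hcF⟩ := hF.exists_dilation
  have hδ : ∀ k : ℕ, ∃ g ∈ F, dilation g = 1 + (c - 1) * (1 / ((k : ℝ) + 1)) ∧
      ∀ h ∈ groupH F, ‖toMat m g - 1‖ ≤ ‖toMat m (g * h) - 1‖ := by
    intro k
    have h0 : 0 < 1 / ((k : ℝ) + 1) := by positivity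
    have h1 : 1 / ((k : ℝ) + 1) ≤ 1 := by
      rw [div_le_one (by positivity)]
      linarith [(Nat.cast_nonneg k : (0 : ℝ) ≤ k)]
    obtain ⟨g, hg, hgd⟩ := hcF (1 + (c - 1) * (1 / ((k : ℝ) + 1))) (by nlinarith) (by nlinarith)
    obtain ⟨a, ha, hmin⟩ := exists_nearest_mul hHc g
    refine ⟨g * a, F.mul_mem hg ha.1, ?_, hmin⟩
    rw [dilation_mul (hF.commute hg) (hF.commute ha.1),
      (mem_groupM_iff_dilation (hF.commute ha.1)).mp ha.2, mul_one, hgd]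
  choose g hgF hgd hgmin using hδ
  have hlim : Tendsto (fun k : ℕ => 1 + (c - 1) * (1 / ((k : ℝ) + 1))) atTop (𝓝 1) := by
    simpa using (tendsto_one_div_add_atTop_nhds_zero_nat.const_mul (c - 1)).const_add (1 : ℝ)
  have hgt : ∀ k : ℕ, 1 < 1 + (c - 1) * (1 / ((k : ℝ) + 1)) := fun k => by
    have h0 : 0 < 1 / ((k : ℝ) + 1) := by positivity
    nlinarith
  have hcpt := isCompact_dilation hF.closed hF.le c
  have : FirstCountableTopology (Mat m) :=
    inferInstanceAs (FirstCountableTopology (Idx m → Idx m → ℂ))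
  have : FirstCountableTopology (SU m) :=
    (isClosedEmbedding_toMat m).isInducing.firstCountableTopology
  obtain ⟨a, ⟨haF, -, -⟩, φ, hφ, ha⟩ := hcpt.tendsto_subseq (x := g) fun k => by
    refine ⟨hgF k, by rw [hgd]; exact (hgt k).le, ?_⟩
    have h0 : 0 < 1 / ((k : ℝ) + 1) := by positivity
    have h1 : 1 / ((k : ℝ) + 1) ≤ 1 := by
      rw [div_le_one (by positivity)]
      linarith [(Nat.cast_nonneg k : (0 : ℝ) ≤ k)]
    rw [hgd]
    nlinarith
  have hda : dilation a = 1 := by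
    refine tendsto_nhds_unique (((continuous_dilation m).tendsto a).comp ha) ?_
    refine (hlim.comp hφ.tendsto_atTop).congr fun k => ?_
    simp only [Function.comp_apply, hgd]
  have haH : a ∈ groupH F := ⟨haF, (mem_groupM_iff_dilation (hF.commute haF)).mpr hda⟩
  -- A subsequence tends to some `a ∈ H`, and the competitor `g a⁻¹` in the same coset tends to `1`.
  have hε0 : Tendsto (fun k => ‖toMat m (g (φ k)) - 1‖) atTop (𝓝 0) := by
    have h1 : Tendsto (fun k => toMat m (g (φ k)) * toMat m a⁻¹) atTop (𝓝 1) := by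
      rw [← toMat_mul_inv a]
      exact (((isClosedEmbedding_toMat m).continuous.tendsto a).comp ha).mul tendsto_const_nhds
    have h2 : Tendsto (fun k => ‖toMat m (g (φ k) * a⁻¹) - 1‖) atTop (𝓝 0) := by
      simpa using (h1.sub_const 1).norm
    exact squeeze_zero (fun k => norm_nonneg _)
      (fun k => hgmin (φ k) a⁻¹ ((groupH F).inv_mem haH)) h2
  have hεpos : ∀ k, 0 < ‖toMat m (g (φ k)) - 1‖ := fun k => by
    rw [norm_pos_iff, sub_ne_zero]
    intro h
    have h1 := hgd (φ k)
    have h2 := hgt (φ k)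
    rw [← h1, dilation, h] at h2
    simp at h2
  have : ProperSpace (Mat m) := FiniteDimensional.proper ℝ (Mat m)
  obtain ⟨X, hX, ψ, hψ, hXlim⟩ := (isCompact_sphere (0 : Mat m) 1).tendsto_subseq
    (x := fun k => ‖toMat m (g (φ k)) - 1‖⁻¹ • (toMat m (g (φ k)) - 1)) fun k => by
      rw [mem_sphere_zero_iff_norm, norm_smul, norm_inv, norm_norm,
        inv_mul_cancel₀ (hεpos k).ne']
  obtain ⟨Y, hYF, rfl⟩ := exists_mem_lieAlg_of_tendsto hF.closed (fun k => hgF (φ (ψ k)))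
    (fun k => hεpos (ψ k)) (hε0.comp hψ.tendsto_atTop) hXlim
  have hfin := (tendsto_smul_mul_exp_sub_one (fun k => hεpos (ψ k)) (hε0.comp hψ.tendsto_atTop)
    hXlim).norm
  rw [norm_zero] at hfin
  refine absurd (ge_of_tendsto' hfin fun k => ?_) (not_le.mpr (zero_lt_one (α := ℝ)))
  -- The competitor `g exp (-εY)`, with `ε = ‖g - 1‖`, is within `o(ε)` of `1`, while minimality
  -- keeps it at distance at least `ε`.
  have h1 := hgmin (φ (ψ k)) (expSU ((-‖toMat m (g (φ (ψ k))) - 1‖) • Y)) (hH Y hYF _)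
  rw [norm_smul, norm_inv, norm_norm, ← div_eq_inv_mul, le_div_iff₀ (hεpos (ψ k)), one_mul,
    smul_neg, ← neg_smul]
  rwa [map_mul] at h1

/-! ## The element `A_r` -/

theorem innerK_add_left {m : ℕ} (X Y Z : su m) : innerK (X + Y) Z = innerK X Z + innerK Y Z := by
  simp [innerK, Matrix.conjTranspose_add, add_mul]

theorem innerK_add_right {m : ℕ} (X Y Z : su m) : innerK X (Y + Z) = innerK X Y + innerK X Z := by
  simp [innerK, mul_add]

theorem innerK_smul_left {m : ℕ} (c : ℝ) (X Y : su m) : innerK (c • X) Y = c * innerK X Y := by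
  simp [innerK, Matrix.conjTranspose_smul]

theorem innerK_smul_right {m : ℕ} (c : ℝ) (X Y : su m) : innerK X (c • Y) = c * innerK X Y := by
  simp [innerK]

theorem eq_zero_of_innerK_self {m : ℕ} {X : su m} (h : innerK X X = 0) : X = 0 := by
  have h1 : innerK X X = ∑ i, ∑ j, ‖(X : Mat m) j i‖ ^ 2 := by
    simp only [innerK, Matrix.trace, Matrix.diag, Matrix.mul_apply, Matrix.conjTranspose_apply,
      Complex.re_sum]
    refine Finset.sum_congr rfl fun i _ => Finset.sum_congr rfl fun j _ => ?_
    rw [Complex.star_def, Complex.conj_mul']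
    norm_cast
  rw [h1, Finset.sum_eq_zero_iff_of_nonneg fun i _ => Finset.sum_nonneg fun j _ => by positivity]
    at h
  apply Subtype.ext
  ext j i
  have h2 := h i (Finset.mem_univ _)
  rw [Finset.sum_eq_zero_iff_of_nonneg fun j _ => by positivity] at h2
  simpa using h2 j (Finset.mem_univ _)

/-- The bilinear form `innerK`. -/
def innerForm (m : ℕ) : su m →ₗ[ℝ] su m →ₗ[ℝ] ℝ :=
  LinearMap.mk₂ ℝ innerK innerK_add_left innerK_smul_left innerK_add_right innerK_smul_right

/-- Orthogonal projection for `k`: definiteness makes `S → S*` injective, hence bijective by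
dimension. -/
theorem exists_orthogonal_sub {m : ℕ} (S : Submodule ℝ (su m)) (X : su m) :
    ∃ Y ∈ S, ∀ Z ∈ S, innerK (X - Y) Z = 0 := by
  let T : S →ₗ[ℝ] Module.Dual ℝ S := ((innerForm m).compl₁₂ S.subtype S.subtype)
  have hT : Function.Injective T := by
    rw [injective_iff_map_eq_zero]
    intro Y hY
    have : innerK (Y : su m) (Y : su m) = 0 := LinearMap.congr_fun hY Y
    exact Subtype.ext (eq_zero_of_innerK_self this)
  have hs : Function.Surjective T :=
    (LinearMap.injective_iff_surjective_of_finrank_eq_finrank (K := ℝ) (V := S)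
      (V₂ := Module.Dual ℝ S) (f := T) (Subspace.dual_finrank_eq (K := ℝ) (V := S)).symm).mp hT
  obtain ⟨Y, hY⟩ := hs ((innerForm m X).comp S.subtype)
  refine ⟨Y, Y.2, fun Z hZ => ?_⟩
  have h1 : innerK (Y : su m) Z = innerK X Z := LinearMap.congr_fun hY ⟨Z, hZ⟩
  have h2 := innerK_add_left (X - (Y : su m)) (Y : su m) Z
  rw [sub_add_cancel, h1] at h2
  linarith

/-- Rescale to `A₀`-component `1`, then subtract the projection to `𝔥`, which has no `A₀`-component.
-/
theorem IsDescription.exists_isAr {m : ℕ} {F : Subgroup (SU m)} (hF : IsDescription F) :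
    ∃ X : su m, IsAr F X := by
  obtain ⟨X, hX, hX0⟩ := hF.exists_re_ne_zero
  set c := ((X : Mat m) (.inr 0) (.inr 0)).re with hc
  obtain ⟨Y, hY, hort⟩ := exists_orthogonal_sub
    (lieSubmodule (groupH F) (isClosed_groupH hF.closed)) (c⁻¹ • X)
  have hYH := mem_lieAlg_inf.mp (mem_lieSubmodule.mp hY)
  have hmem : c⁻¹ • X - Y ∈ lieAlg F :=
    (lieSubmodule F hF.closed).sub_mem (smul_mem_lieAlg hX _) hYH.1
  refine ⟨c⁻¹ • X - Y, hmem, mem_lieAlg_groupM_of_commute ?_ ?_, hort⟩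
  · exact (hF.commute_lieAlg hmem).sub_left (Commute.refl _)
  · have h1 := (hF.commute_lieAlg hYH.1)
    have h2 : ((Y : Mat m) (.inr 0) (.inr 0)).re = 0 := by
      obtain ⟨B, a, d, hB⟩ := commute_A0_iff.mp h1
      have h3 := (mem_lieAlg_groupM_iff.mp hYH.2).2
      have h4 := fromBlocks_mem_su hB
      rw [hB, commute_swapMat_iff] at h3
      have h5 := congrArg Complex.re h4
      simp [h3] at h5
      simp [hB, h3]
      linarith
    simp [h2, ← hc, A0, inv_mul_cancel₀ hX0]

/-! ## Calculus in the affine coordinates -/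

theorem coe_extChartAt {m : ℕ} (p : CH m) : ⇑(extChartAt 𝓘(ℝ, Model m) p) = affine := rfl

theorem extChartAt_symm_affine {m : ℕ} (p q : CH m) :
    (extChartAt 𝓘(ℝ, Model m) p).symm (affine q) = q :=
  (extChartAt 𝓘(ℝ, Model m) p).left_inv (by simp [extChartAt, chartAt, ChartedSpace.chartAt])

theorem affine_extChartAt_symm {m : ℕ} (p : CH m) :
    ∀ᶠ q in nhds (affine p), affine ((extChartAt 𝓘(ℝ, Model m) p).symm q) = q := by
  filter_upwards [(isOpen_siegel m).mem_nhds (range_affine ▸ Set.mem_range_self p)] with q hq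
  rw [← range_affine] at hq
  obtain ⟨p', rfl⟩ := hq
  rw [extChartAt_symm_affine]

theorem hasMFDerivAt_of_affine {m : ℕ} {E : Type*} [NormedAddCommGroup E] [NormedSpace ℝ E]
    {f : E → CH m} {f' : E →L[ℝ] Model m} {x : E}
    (h : HasFDerivAt (fun y => affine (f y)) f' x) :
    HasMFDerivAt 𝓘(ℝ, E) 𝓘(ℝ, Model m) f x f' := by
  refine ⟨(isOpenEmbedding_affine m).isInducing.continuousAt_iff.mpr h.continuousAt, ?_⟩
  simp only [writtenInExtChartAt, mfld_simps]
  exact h.hasFDerivWithinAt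

theorem hasMFDerivAt_of_comp_affine {m : ℕ} {f : CH m → CH m} {φ : Model m → Model m}
    {φ' : Model m →L[ℝ] Model m} {p : CH m} (hf : ∀ q, affine (f q) = φ (affine q))
    (h : HasFDerivAt φ φ' (affine p)) :
    HasMFDerivAt 𝓘(ℝ, Model m) 𝓘(ℝ, Model m) f p φ' := by
  refine ⟨(isOpenEmbedding_affine m).isInducing.continuousAt_iff.mpr ?_, ?_⟩
  · have : affine ∘ f = φ ∘ affine := funext hf
    rw [this]
    exact h.continuousAt.comp (isOpenEmbedding_affine m).continuous.continuousAt
  · refine (h.congr_of_eventuallyEq ?_).hasFDerivWithinAt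
    filter_upwards [affine_extChartAt_symm p] with q hq
    simp only [writtenInExtChartAt, Function.comp_apply, coe_extChartAt, hf, hq]

theorem hasMFDerivAt_comp_affine {m : ℕ} {E : Type*} [NormedAddCommGroup E] [NormedSpace ℝ E]
    {φ : Model m → E} {φ' : Model m →L[ℝ] E} {p : CH m} (h : HasFDerivAt φ φ' (affine p)) :
    HasMFDerivAt 𝓘(ℝ, Model m) 𝓘(ℝ, E) (fun q => φ (affine q)) p φ' := by
  refine ⟨h.continuousAt.comp (isOpenEmbedding_affine m).continuous.continuousAt, ?_⟩
  refine (h.congr_of_eventuallyEq ?_).hasFDerivWithinAt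
  filter_upwards [affine_extChartAt_symm p] with q hq
  change φ (affine ((extChartAt 𝓘(ℝ, Model m) p).symm q)) = φ q
  rw [hq]

/-- There is a single chart, so the coordinate change is the identity and vector fields are plain
functions into `Model m`. -/
theorem trivializationAt_snd {m : ℕ} (p q : CH m) (v : TangentSpace 𝓘(ℝ, Model m) q) :
    (trivializationAt (Model m) (TangentSpace 𝓘(ℝ, Model m)) p
      (⟨q, v⟩ : TangentBundle 𝓘(ℝ, Model m) (CH m))).2 = v :=
  tangentCoordChange_self (I := 𝓘(ℝ, Model m)) (x := p) (z := q)
    (by simp [extChartAt, chartAt, ChartedSpace.chartAt])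

/-- The vector field with the coordinate expression `φ`. -/
def coordField {m : ℕ} (φ : Model m → Model m) : VField m := fun p => φ (affine p)

theorem isSmooth_coordField {m : ℕ} {φ : Model m → Model m} (hφ : ContDiff ℝ ∞ φ) :
    IsSmooth (coordField φ) := by
  intro p
  refine (Bundle.contMDiffAt_section p).mpr ?_
  simp only [trivializationAt_snd]
  have h : ContMDiff 𝓘(ℝ, Model m) 𝓘(ℝ, Model m) ∞ (affine (m := m)) :=
    contMDiff_isOpenEmbedding (isOpenEmbedding_affine m)
  exact (hφ.contMDiff.comp h) p

theorem mdifferentiableAt_coordField {m : ℕ} {φ : Model m → Model m} (p : CH m)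
    (hφ : DifferentiableAt ℝ φ (affine p)) :
    MDifferentiableAt 𝓘(ℝ, Model m) 𝓘(ℝ, Model m).tangent
      (fun q => (⟨q, coordField φ q⟩ : TangentBundle 𝓘(ℝ, Model m) (CH m))) p := by
  refine (mdifferentiableAt_section _ (coordField φ)).mpr ?_
  simp only [trivializationAt_snd]
  exact (hasMFDerivAt_comp_affine hφ.hasFDerivAt).mdifferentiableAt

/-- Expand the field in a constant frame. In the Leibniz rule the terms with derivatives of the
frame are multiplied by coefficients that vanish at `p`, so the connection drops out. -/
theorem nabla_coordField_of_eq_zero {m : ℕ} (nabla : Connection m) {φ : Model m → Model m}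
    {p : CH m} (hφ : DifferentiableAt ℝ φ (affine p)) (h0 : φ (affine p) = 0)
    (v : TangentSpace 𝓘(ℝ, Model m) p) :
    nabla (coordField φ) p v = fderiv ℝ φ (affine p) v := by
  let b := Module.finBasis ℝ (Model m)
  let L : Fin _ → Model m →L[ℝ] ℝ := fun i => LinearMap.toContinuousLinearMap (b.coord i)
  have hsum : ∀ x : Model m, ∑ i, L i x • b i = x := fun x => b.sum_repr x
  have key : ∀ s : Finset (Fin (Module.finrank ℝ (Model m))),
      nabla (coordField fun q => ∑ i ∈ s, L i (φ q) • b i) p v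
        = ∑ i ∈ s, L i (fderiv ℝ φ (affine p) v) • b i := by
    intro s
    induction s using Finset.induction_on with
    | empty =>
      have : (coordField fun q : Model m => ∑ i ∈ (∅ : Finset (Fin _)), L i (φ q) • b i)
          = (0 : VField m) := by
        funext p
        simp only [coordField, Finset.sum_empty]
        rfl
      rw [this, nabla.zero]
      rfl
    | insert i s hi ih =>
      have hterm : ∀ j, DifferentiableAt ℝ (fun q => L j (φ q)) (affine p) := fun j =>
        (L j).differentiableAt.comp _ hφ
      let f : CH m → ℝ := fun q => L i (φ (affine q))
      let e : VField m := coordField fun _ => b i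
      let r : VField m := coordField fun q => ∑ j ∈ s, L j (φ q) • b j
      have h1 : (coordField fun q => ∑ j ∈ insert i s, L j (φ q) • b j) = f • e + r := by
        funext q
        simp only [coordField, Finset.sum_insert hi]
        rfl
      have hd : HasMFDerivAt 𝓘(ℝ, Model m) 𝓘(ℝ, ℝ) f p ((L i).comp (fderiv ℝ φ (affine p))) :=
        hasMFDerivAt_comp_affine (φ := fun q => L i (φ q)) ((L i).hasFDerivAt.comp _ hφ.hasFDerivAt)
      have h4 : nabla (f • e + r) p = nabla (f • e) p + nabla r p :=
        nabla.isCovariantDerivativeOnUniv.add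
          (mdifferentiableAt_coordField (φ := fun q => L i (φ q) • b i) p
            ((hterm i).smul_const _))
          (mdifferentiableAt_coordField p (DifferentiableAt.fun_sum fun j _ =>
            (hterm j).smul_const _))
      have h5 := nabla.isCovariantDerivativeOnUniv.leibniz (σ := e)
        (mdifferentiableAt_coordField p (differentiableAt_const _)) hd.mdifferentiableAt
      have hf : f p = 0 := by simp only [f, h0, map_zero]
      rw [hf, zero_smul, zero_add] at h5
      rw [h1, h4, h5, Finset.sum_insert hi, ← ih]
      change @HAdd.hAdd (Model m) (Model m) (Model m) _ ((mvfderiv 𝓘(ℝ, Model m) f p v) • b i)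
        (nabla r p v) = _
      simp only [mvfderiv, hd.mfderiv]
      rfl
  have := key Finset.univ
  simp only [hsum] at this
  exact this

/-! ## The action in the affine coordinates -/

theorem lift_affine_neg {m : ℕ} (p : CH m) :
    (herm (lift (affine p)) (lift (affine p))).re < 0 := by
  rw [herm_lift]
  have : affine p ∈ siegel m := range_affine ▸ Set.mem_range_self p
  exact this

theorem mk_lift_affine {m : ℕ} (p : CH m) : CH.mk (lift (affine p)) (lift_affine_neg p) = p := by
  apply affine_injective
  rw [affine_mk]
  refine Prod.ext (funext fun i => ?_) ?_ <;> simp [lift]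

theorem smul_mk {m : ℕ} (g : SU m) (v : Idx m → ℂ) (h : (herm v v).re < 0) :
    g • CH.mk v h = CH.mk (toMat m g *ᵥ v) (by rw [toMat_apply, herm_mulVec]; exact h) := by
  have hv : v ≠ 0 := fun h0 => last_ne_zero h (by rw [h0]; rfl)
  exact Subtype.ext (Projectivization.smul_mk g.1 hv)

theorem affine_smul {m : ℕ} (g : SU m) (p : CH m) :
    affine (g • p) = (fun i => (toMat m g *ᵥ lift (affine p)) (.inl i)
        / (toMat m g *ᵥ lift (affine p)) (.inr 1),
      (toMat m g *ᵥ lift (affine p)) (.inr 0) / (toMat m g *ᵥ lift (affine p)) (.inr 1)) := by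
  conv_lhs => rw [← mk_lift_affine p, smul_mk, affine_mk]

/-- The coordinates of the base point. -/
theorem affine_basePoint (m : ℕ) : affine (basePoint m) = (0, -1) := by
  rw [basePoint, affine_mk]
  refine Prod.ext (funext fun i => ?_) ?_ <;> simp

/-- The coordinate expression of the infinitesimal generator of a matrix. -/
def vel {m : ℕ} (X : Mat m) (q : Model m) : Model m :=
  (fun i => (X *ᵥ lift q) (.inl i) - q.1 i * (X *ᵥ lift q) (.inr 1),
    (X *ᵥ lift q) (.inr 0) - q.2 * (X *ᵥ lift q) (.inr 1))

open scoped Matrix.Norms.Operator in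
theorem hasDerivAt_exp_mulVec {m : ℕ} (X : Mat m) (x : Idx m → ℂ) (i : Idx m) :
    HasDerivAt (fun t : ℝ => (NormedSpace.exp (t • X) *ᵥ x) i) ((X *ᵥ x) i) 0 := by
  let L : Mat m →ₗ[ℝ] ℂ :=
    { toFun := fun A => (A *ᵥ x) i
      map_add' := fun A B => by rw [Matrix.add_mulVec]; rfl
      map_smul' := fun c A => by rw [Matrix.smul_mulVec]; rfl }
  exact (LinearMap.toContinuousLinearMap L).hasFDerivAt.comp_hasDerivAt (0 : ℝ)
    (hasDerivAt_exp_smul_zero X)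

theorem fund_eq {m : ℕ} (X : su m) : fund X = coordField (vel (X : Mat m)) := by
  funext p
  have hτ : (lift (affine p)) (.inr 1) = 1 := rfl
  have h0 : NormedSpace.exp ((0 : ℝ) • (X : Mat m)) = 1 := by
    rw [zero_smul, NormedSpace.exp_zero]
  have hquot : ∀ i, HasDerivAt (fun t : ℝ => (NormedSpace.exp (t • (X : Mat m)) *ᵥ lift (affine p)) i
      / (NormedSpace.exp (t • (X : Mat m)) *ᵥ lift (affine p)) (.inr 1))
      (((X : Mat m) *ᵥ lift (affine p)) i
        - lift (affine p) i * ((X : Mat m) *ᵥ lift (affine p)) (.inr 1)) 0 := by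
    intro i
    have := (hasDerivAt_exp_mulVec (X : Mat m) (lift (affine p)) i).div
      (hasDerivAt_exp_mulVec (X : Mat m) (lift (affine p)) (.inr 1))
      (by rw [h0, Matrix.one_mulVec, hτ]; exact one_ne_zero)
    simp only [h0, Matrix.one_mulVec, hτ, mul_one, one_pow, div_one] at this
    exact this
  have hd : HasDerivAt (fun t : ℝ => affine (expSU (t • X) • p)) (vel (X : Mat m) (affine p)) 0 := by
    have := (hasDerivAt_pi.mpr fun i => hquot (.inl i)).prodMk (hquot (.inr 0))
    refine this.congr_of_eventuallyEq (Filter.Eventually.of_forall fun t => ?_)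
    exact affine_smul _ _
  have := (hasMFDerivAt_of_affine hd.hasFDerivAt).mfderiv
  change (mfderiv 𝓘(ℝ, ℝ) 𝓘(ℝ, Model m) (fun t : ℝ => expSU (t • X) • p) 0 (1 : ℝ) : Model m) = _
  rw [this]
  exact one_smul ℝ (vel (X : Mat m) (affine p))

/-- The direction `(w, ζ, 0)`. -/
def dir (m : ℕ) : Model m →ₗ[ℝ] (Idx m → ℂ) where
  toFun u := Sum.elim u.1 ![u.2, 0]
  map_add' u v := by
    funext i
    rcases i with i | i
    · rfl
    · fin_cases i <;> simp
  map_smul' c u := by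
    funext i
    rcases i with i | i
    · rfl
    · fin_cases i <;> simp

theorem lift_add {m : ℕ} (q u : Model m) : lift (q + u) = lift q + dir m u := by
  funext i
  rcases i with i | i
  · rfl
  · fin_cases i <;> simp [lift, dir]

theorem contDiff_vel {m : ℕ} (X : Mat m) : ContDiff ℝ ∞ (vel X) := by
  have h : ∀ i, ContDiff ℝ ∞ fun q : Model m => (X *ᵥ lift q) i := by
    intro i
    simp only [Matrix.mulVec, dotProduct, lift, Fintype.sum_sum_type, Fin.sum_univ_two,
      Sum.elim_inl, Sum.elim_inr, Matrix.cons_val_zero, Matrix.cons_val_one]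
    fun_prop
  unfold vel
  fun_prop

theorem fderiv_vel {m : ℕ} (X : Mat m) (q u : Model m) :
    fderiv ℝ (vel X) q u =
      (fun i => (X *ᵥ dir m u) (.inl i) - (u.1 i * (X *ᵥ lift q) (.inr 1)
          + q.1 i * (X *ᵥ dir m u) (.inr 1)),
        (X *ᵥ dir m u) (.inr 0) - (u.2 * (X *ᵥ lift q) (.inr 1)
          + q.2 * (X *ᵥ dir m u) (.inr 1))) := by
  have hdiff : DifferentiableAt ℝ (vel X) q :=
    (contDiff_vel X).contDiffAt.differentiableAt (by simp)
  rw [← hdiff.lineDeriv_eq_fderiv]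
  refine HasLineDerivAt.lineDeriv ?_
  have hx : ∀ i, HasDerivAt (fun t : ℝ => (X *ᵥ lift (q + t • u)) i) ((X *ᵥ dir m u) i) 0 := by
    intro i
    have h1 : (fun t : ℝ => (X *ᵥ lift (q + t • u)) i)
        = fun t : ℝ => (X *ᵥ lift q) i + t • (X *ᵥ dir m u) i := by
      funext t
      rw [lift_add, map_smul, Matrix.mulVec_add, Matrix.mulVec_smul]
      rfl
    rw [h1]
    simpa using ((hasDerivAt_id (0 : ℝ)).smul_const ((X *ᵥ dir m u) i)).const_add
      ((X *ᵥ lift q) i)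
  have hline : ∀ z w : ℂ, HasDerivAt (fun t : ℝ => z + t • w) w 0 := fun z w => by
    simpa using ((hasDerivAt_id (0 : ℝ)).smul_const w).const_add z
  have h1 : ∀ i, HasDerivAt (fun t : ℝ => (vel X (q + t • u)).1 i) ((X *ᵥ dir m u) (.inl i) -
      (u.1 i * (X *ᵥ lift q) (.inr 1) + q.1 i * (X *ᵥ dir m u) (.inr 1))) 0 := by
    intro i
    have := (hx (.inl i)).sub ((hline (q.1 i) (u.1 i)).mul (hx (.inr 1)))
    simp only [zero_smul, add_zero] at this
    exact this
  have h2 : HasDerivAt (fun t : ℝ => (vel X (q + t • u)).2) ((X *ᵥ dir m u) (.inr 0) -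
      (u.2 * (X *ᵥ lift q) (.inr 1) + q.2 * (X *ᵥ dir m u) (.inr 1))) 0 := by
    have := (hx (.inr 0)).sub ((hline q.2 u.2).mul (hx (.inr 1)))
    simp only [zero_smul, add_zero] at this
    exact this
  exact (hasDerivAt_pi.mpr h1).prodMk h2

/-! ## The stabilizer of a point at infinity and its invariant fields -/

/-- The point at infinity fixed by `S(U(n-1)U(1))AN`. -/
def cusp (m : ℕ) : Idx m → ℂ := Pi.single (.inr 0) 1

theorem herm_cusp {m : ℕ} (x : Idx m → ℂ) : herm x (cusp m) = x (.inr 1) := by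
  simp [herm, cusp]

/-- The stabilizer of the point at infinity. -/
def parabolic (m : ℕ) : Subgroup (SU m) where
  carrier := {g | ∃ c : ℂ, toMat m g *ᵥ cusp m = c • cusp m}
  one_mem' := ⟨1, by simp⟩
  mul_mem' := by
    rintro g h ⟨c, hc⟩ ⟨d, hd⟩
    refine ⟨d * c, ?_⟩
    rw [map_mul, ← Matrix.mulVec_mulVec, hd, Matrix.mulVec_smul, hc, smul_smul]
  inv_mem' := by
    rintro g ⟨c, hc⟩
    have h1 : cusp m = c • (toMat m g⁻¹ *ᵥ cusp m) := by
      rw [← Matrix.mulVec_smul, ← hc, Matrix.mulVec_mulVec, toMat_inv_mul, Matrix.one_mulVec]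
    have hc0 : c ≠ 0 := by
      rintro rfl
      have := congrFun h1 (.inr 0)
      simp [cusp] at this
    refine ⟨c⁻¹, ?_⟩
    conv_rhs => rw [h1]
    rw [inv_smul_smul₀ hc0]

/-- The distance from the boundary of the Siegel domain. -/
def height {m : ℕ} (q : Model m) : ℝ := -(∑ i, ‖q.1 i‖ ^ 2) / 2 - q.2.re

theorem height_eq_herm {m : ℕ} (q : Model m) : height q = -(herm (lift q) (lift q)).re / 2 := by
  rw [herm_lift, height]
  ring

theorem height_pos {m : ℕ} (p : CH m) : 0 < height (affine p) := by
  rw [height_eq_herm]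
  linarith [lift_affine_neg p]

theorem contDiff_height (m : ℕ) : ContDiff ℝ ∞ (height (m := m)) := by
  unfold height
  refine ContDiff.sub (ContDiff.div_const (ContDiff.neg (ContDiff.sum fun i _ => ?_)) _)
    (Complex.reCLM.contDiff.comp contDiff_snd)
  exact ContDiff.norm_sq ℝ (by fun_prop)

/-- The field `κ · height` in the direction of the last coordinate. -/
def vertical {m : ℕ} (κ : ℂ) : VField m := coordField fun q => (0, height q • κ)

theorem contDiff_vertical {m : ℕ} (κ : ℂ) :
    ContDiff ℝ ∞ fun q : Model m => ((0 : Fin m → ℂ), height q • κ) :=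
  contDiff_const.prodMk ((contDiff_height m).smul contDiff_const)

/-- The last coordinate is the pairing with the cusp vector, which `g` only rescales. The
denominator of the projective action is therefore constant, and the action in coordinates is affine.
-/
theorem mulVec_last_of_parabolic {m : ℕ} {g : SU m} {c : ℂ}
    (hc : toMat m g *ᵥ cusp m = c • cusp m) (x : Idx m → ℂ) :
    star c * (toMat m g *ᵥ x) (.inr 1) = x (.inr 1) := by
  have h1 := herm_mulVec g x (cusp m)
  rw [herm_cusp] at h1
  rw [← h1]
  change _ = herm (toMat m g *ᵥ x) (toMat m g *ᵥ cusp m)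
  rw [hc]
  simp [herm, cusp]

theorem affine_smul_of_parabolic {m : ℕ} {g : SU m} {c : ℂ}
    (hc : toMat m g *ᵥ cusp m = c • cusp m) (p : CH m) :
    affine (g • p) = (fun i => star c * (toMat m g *ᵥ lift (affine p)) (.inl i),
      star c * (toMat m g *ᵥ lift (affine p)) (.inr 0)) := by
  have h1 : star c * (toMat m g *ᵥ lift (affine p)) (.inr 1) = 1 := mulVec_last_of_parabolic hc _
  have h2 : (toMat m g *ᵥ lift (affine p)) (.inr 1) ≠ 0 := right_ne_zero_of_mul_eq_one h1
  have h3 : ∀ z : ℂ, z / (toMat m g *ᵥ lift (affine p)) (.inr 1) = star c * z := fun z => by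
    rw [div_eq_iff h2]
    linear_combination -z * h1
  rw [affine_smul]
  simp only [h3]

theorem height_smul_of_parabolic {m : ℕ} {g : SU m} {c : ℂ}
    (hc : toMat m g *ᵥ cusp m = c • cusp m) (p : CH m) :
    height (affine (g • p)) = ‖c‖ ^ 2 * height (affine p) := by
  have h1 : lift (affine (g • p)) = star c • (toMat m g *ᵥ lift (affine p)) := by
    rw [affine_smul_of_parabolic hc]
    funext i
    rcases i with i | i
    · rfl
    · fin_cases i
      · rfl
      · exact (mulVec_last_of_parabolic hc (lift (affine p))).symm
  rw [height_eq_herm, height_eq_herm, h1, herm_smul_self_re, toMat_apply, herm_mulVec, norm_star]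
  ring

/-- The linear part of `g` multiplies the vertical direction by `conj c * c`, and `height` grows by
the same factor. -/
theorem isInvariantField_vertical {m : ℕ} (κ : ℂ) :
    IsInvariantField (parabolic m) (vertical κ) := by
  rintro g ⟨c, hc⟩ p
  let L : Model m →ₗ[ℝ] Model m :=
    { toFun := fun u => (fun i => star c * (toMat m g *ᵥ dir m u) (.inl i),
        star c * (toMat m g *ᵥ dir m u) (.inr 0))
      map_add' := fun u v => by
        rw [map_add, Matrix.mulVec_add]
        simp only [Pi.add_apply, mul_add]
        rfl
      map_smul' := fun t u => by
        rw [map_smul, Matrix.mulVec_smul]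
        simp only [Pi.smul_apply, mul_smul_comm]
        rfl }
  have hL : ∀ q, affine (g • q) = L.toContinuousLinearMap (affine q) +
      (fun i => star c * (toMat m g *ᵥ lift 0) (.inl i),
        star c * (toMat m g *ᵥ lift 0) (.inr 0)) := fun q => by
    rw [affine_smul_of_parabolic hc]
    nth_rewrite 1 2 [← zero_add (affine q)]
    rw [lift_add, Matrix.mulVec_add]
    simp only [Pi.add_apply, mul_add, add_comm]
    rfl
  have hd := hasMFDerivAt_of_comp_affine (p := p) hL
    (L.toContinuousLinearMap.hasFDerivAt.add_const _)
  rw [dAct, hd.mfderiv]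
  change L (0, height (affine p) • κ) = (0, height (affine (g • p)) • κ)
  rw [height_smul_of_parabolic hc]
  have h1 : dir m (0, height (affine p) • κ) = (height (affine p) • κ) • cusp m := by
    funext i
    rcases i with i | i
    · simp [dir, cusp]
    · fin_cases i <;> simp [dir, cusp]
  have h2 : star c * c = ((‖c‖ ^ 2 : ℝ) : ℂ) := by
    rw [Complex.star_def, Complex.conj_mul']
    norm_cast
  change ((fun i => star c * (toMat m g *ᵥ dir m _) (.inl i)),
    star c * (toMat m g *ᵥ dir m _) (.inr 0)) = _
  rw [h1, Matrix.mulVec_smul, hc]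
  refine Prod.ext (funext fun i => ?_) ?_
  · simp [cusp]
  · simp only [cusp, Pi.smul_apply, Pi.single_eq_same, smul_eq_mul, mul_one, Complex.real_smul,
      Complex.ofReal_mul, ← h2]
    ring

/-! ## The nilpotent group -/

theorem nilMat_mulVec {m : ℕ} (v : Fin m → ℂ) (b : ℝ) (x : Idx m → ℂ) :
    nilMat v b *ᵥ x = Sum.elim (fun i => v i * x (.inr 1))
      ![-(∑ j, star (v j) * x (.inl j)) + Complex.I * b * x (.inr 1), 0] := by
  funext i
  rcases i with i | i
  · simp [nilMat, Matrix.mulVec, dotProduct, Fin.sum_univ_two]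
  · fin_cases i <;> simp [nilMat, Matrix.mulVec, dotProduct, Fin.sum_univ_two]

/-- This makes the exponential on `𝔫` a quadratic polynomial, so its action can be computed
explicitly. -/
theorem nilMat_pow_three {m : ℕ} (v : Fin m → ℂ) (b : ℝ) : nilMat v b ^ 3 = 0 := by
  apply Matrix.mulVec_injective
  funext x
  rw [pow_succ, pow_two, ← Matrix.mulVec_mulVec, ← Matrix.mulVec_mulVec, nilMat_mulVec v b x,
    nilMat_mulVec, nilMat_mulVec, Matrix.zero_mulVec]
  funext i
  rcases i with i | i
  · simp
  · fin_cases i <;> simp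

open scoped Matrix.Norms.Operator in
theorem exp_mulVec_of_pow_three {m : ℕ} {X : Mat m} (hX : X ^ 3 = 0) (x : Idx m → ℂ) :
    NormedSpace.exp X *ᵥ x = x + X *ᵥ x + (1 / 2 : ℂ) • (X *ᵥ (X *ᵥ x)) := by
  have h1 : NormedSpace.exp X = 1 + X + (1 / 2 : ℂ) • (X * X) := by
    rw [NormedSpace.exp_eq_tsum ℂ]
    simp only
    rw [tsum_eq_sum (s := Finset.range 3) fun n hn => ?_]
    · simp [Finset.sum_range_succ, Nat.factorial, pow_two]
    · have : 3 ≤ n := by simpa using hn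
      rw [pow_eq_zero_of_le this hX, smul_zero]
  rw [h1, Matrix.add_mulVec, Matrix.add_mulVec, Matrix.one_mulVec, Matrix.smul_mulVec,
    Matrix.mulVec_mulVec]

theorem exp_nil_mulVec {m : ℕ} (v : Fin m → ℂ) (b : ℝ) (x : Idx m → ℂ) :
    NormedSpace.exp ((nil v b : su m) : Mat m) *ᵥ x
      = x + nilMat v b *ᵥ x + (1 / 2 : ℂ) • (nilMat v b *ᵥ (nilMat v b *ᵥ x)) :=
  exp_mulVec_of_pow_three (nilMat_pow_three v b) x

theorem smul_nil {m : ℕ} (t : ℝ) (v : Fin m → ℂ) (b : ℝ) :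
    t • nil v b = nil (t • v) (t * b) := by
  apply Subtype.ext
  apply Matrix.mulVec_injective
  funext x
  change (t • nilMat v b) *ᵥ x = nilMat (t • v) (t * b) *ᵥ x
  rw [Matrix.smul_mulVec, nilMat_mulVec, nilMat_mulVec]
  funext i
  rcases i with i | i
  · simp [mul_assoc]
  · fin_cases i
    · simp [Finset.mul_sum, mul_assoc]
      ring
    · simp

theorem nil_mem_lieAlg {m : ℕ} (v : Fin m → ℂ) (b : ℝ) : nil v b ∈ lieAlg (groupN m) := fun t => by
  rw [smul_nil]
  exact Subgroup.subset_closure ⟨_, _, rfl⟩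

theorem groupN_le_parabolic (m : ℕ) : groupN m ≤ parabolic m := by
  refine (Subgroup.closure_le _).mpr ?_
  rintro _ ⟨v, b, rfl⟩
  refine ⟨1, ?_⟩
  rw [toMat_expSU, exp_nil_mulVec]
  have : nilMat v b *ᵥ cusp m = 0 := by
    rw [nilMat_mulVec]
    funext i
    rcases i with i | i
    · simp [cusp]
    · fin_cases i <;> simp [cusp]
  rw [this, Matrix.mulVec_zero]
  simp

theorem mem_parabolic_of_commute {m : ℕ} {g : SU m} (hg : Commute (toMat m g) (A0 m : Mat m)) :
    g ∈ parabolic m := by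
  obtain ⟨B, a, d, h⟩ := commute_A0_iff.mp hg
  refine ⟨a, ?_⟩
  rw [h, cusp, Matrix.mulVec_single_one]
  funext i
  rcases i with i | i
  · simp
  · fin_cases i <;> simp

theorem IsDescription.groupG_le_parabolic {m : ℕ} {F : Subgroup (SU m)} (hF : IsDescription F) :
    groupG F ≤ parabolic m :=
  sup_le (fun _ hg => mem_parabolic_of_commute (hF.commute hg)) (groupN_le_parabolic m)

theorem isInducedBy_vertical {m : ℕ} {F : Subgroup (SU m)} (hF : IsDescription F) {X : su m}
    {κ : ℂ} (hX : vel (X : Mat m) (0, -1) = (0, κ)) : IsInducedBy (groupG F) X (vertical κ) where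
  smooth := isSmooth_coordField (contDiff_vertical κ)
  invariant := fun g hg => isInvariantField_vertical κ g (hF.groupG_le_parabolic hg)
  at_base := by
    rw [fund_eq]
    simp only [coordField, vertical, affine_basePoint, hX, height]
    simp
    rfl

/-! ## Transitivity -/

theorem exp_A0_mulVec {m : ℕ} (t : ℝ) (a d : ℂ) :
    NormedSpace.exp (t • (A0 m : Mat m)) *ᵥ Sum.elim (0 : Fin m → ℂ) ![a, d]
      = Sum.elim (0 : Fin m → ℂ) ![Real.exp t * a, Real.exp (-t) * d] := by
  have h : t • (A0 m : Mat m) = Matrix.diagonal (Sum.elim (0 : Fin m → ℂ) ![(t : ℂ), -t]) := by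
    ext i j
    rcases i with i | i <;> rcases j with j | j
    · simp [A0, Matrix.diagonal_apply]
    · simp [A0]
    · simp [A0]
    · fin_cases i <;> fin_cases j <;> simp [A0]
  rw [h, Matrix.exp_diagonal]
  funext i
  rw [Matrix.mulVec_diagonal, Pi.coe_exp]
  rcases i with i | i
  · simp
  · fin_cases i <;> simp [Complex.exp_eq_exp_ℂ]

theorem groupM_smul_basePoint {m : ℕ} {g : SU m} (hg : g ∈ groupM m) :
    g • basePoint m = basePoint m := by
  apply affine_injective
  obtain ⟨B, -, z, hz, h⟩ := hg
  have h' : toMat m g = Matrix.fromBlocks B 0 0 !![z, 0; 0, z] := h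
  have hz0 : z ≠ 0 := norm_ne_zero_iff.mp (hz ▸ one_ne_zero)
  have hx : toMat m g *ᵥ lift (0, -1) = Sum.elim (0 : Fin m → ℂ) ![-z, z] := by
    rw [h', lift, Matrix.fromBlocks_mulVec]
    funext i
    rcases i with i | i
    · simp
    · fin_cases i <;> simp
  rw [affine_smul, affine_basePoint, hx]
  refine Prod.ext (funext fun i => ?_) ?_
  · simp
  · simp [hz0]

theorem IsAr.commute {m : ℕ} {F : Subgroup (SU m)} {X : su m} (hX : IsAr F X) :
    Commute (X : Mat m) (A0 m : Mat m) := by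
  have h := (mem_lieAlg_groupM_iff.mp hX.sub_mem).1.add_left (Commute.refl (A0 m : Mat m))
  simpa using h

/-- `X - A₀` commutes with `A₀` and generates a group fixing `o`, so the orbit of `o` is the one of
`A`. -/
theorem IsAr.affine_smul_basePoint {m : ℕ} {F : Subgroup (SU m)} {X : su m} (hX : IsAr F X)
    (t : ℝ) : affine (expSU (t • X) • basePoint m) = (0, ((-Real.exp (2 * t) : ℝ) : ℂ)) := by
  have h1 : expSU (t • X) = expSU (t • A0 m) * expSU (t • (X - A0 m)) := by
    apply toMat_injective
    rw [map_mul, toMat_expSU, toMat_expSU, toMat_expSU, ← Matrix.exp_add_of_commute]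
    · congr 1
      change t • (X : Mat m) = t • (A0 m : Mat m) + t • ((X : Mat m) - A0 m)
      rw [← smul_add, add_sub_cancel]
    · exact ((hX.commute.symm.sub_right (Commute.refl _)).smul_left t).smul_right t
  have hx : toMat m (expSU (t • A0 m)) *ᵥ lift (0, -1)
      = Sum.elim (0 : Fin m → ℂ) ![Real.exp t * -1, Real.exp (-t) * 1] := exp_A0_mulVec t (-1) 1
  rw [h1, mul_smul, groupM_smul_basePoint (hX.sub_mem t), affine_smul, affine_basePoint, hx]
  refine Prod.ext (funext fun i => ?_) ?_
  · simp
  · simp only [Sum.elim_inr, Matrix.cons_val_zero, Matrix.cons_val_one, mul_one]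
    rw [mul_neg_one, neg_div, ← Complex.ofReal_div, ← Real.exp_sub]
    push_cast
    ring_nf

/-- Horospherical coordinates: `exp (t A_r)` with `e^(2t) = height` reaches the right horosphere,
and `exp (nil w (Im ζ))` then moves `(0, -height)` to `(w, ζ)`. -/
theorem IsAr.exists_smul_basePoint {m : ℕ} {F : Subgroup (SU m)} {X : su m} (hX : IsAr F X)
    (p : CH m) : ∃ g ∈ groupG F, g • basePoint m = p := by
  set w := (affine p).1 with hw
  set ζ := (affine p).2 with hζ
  have hr := height_pos p
  refine ⟨expSU (nil w ζ.im) * expSU ((Real.log (height (affine p)) / 2) • X),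
    Subgroup.mul_mem _ ?_ ?_, affine_injective ?_⟩
  · exact Subgroup.mem_sup_right (Subgroup.subset_closure ⟨_, _, rfl⟩)
  · exact Subgroup.mem_sup_left (hX.mem _)
  rw [mul_smul, affine_smul, hX.affine_smul_basePoint, mul_div_cancel₀ _ two_ne_zero,
    Real.exp_log hr]
  have hx : toMat m (expSU (nil w ζ.im)) *ᵥ lift (0, ((-height (affine p) : ℝ) : ℂ))
      = lift (affine p) := by
    rw [toMat_expSU, exp_nil_mulVec, nilMat_mulVec w ζ.im (lift _), nilMat_mulVec]
    funext i
    rcases i with i | i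
    · simp [lift, hw]
    · fin_cases i
      · have hs : ∑ j, star (w j) * w j = ((∑ j, ‖w j‖ ^ 2 : ℝ) : ℂ) := by
          rw [Complex.ofReal_sum]
          refine Finset.sum_congr rfl fun j _ => ?_
          rw [Complex.star_def, Complex.conj_mul']
          norm_cast
        have h2 : (ζ : ℂ) = ζ.re + ζ.im * Complex.I := (Complex.re_add_im ζ).symm
        simp only [Fin.zero_eta, Pi.add_apply, Pi.smul_apply, lift, Sum.elim_inr, Sum.elim_inl,
          Matrix.cons_val_zero, Matrix.cons_val_one, mul_one, hs, height, mul_zero, add_zero,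
          smul_eq_mul, Pi.zero_apply, Finset.sum_const_zero, neg_zero, zero_add]
        rw [← hw, ← hζ]
        push_cast
        nth_rewrite 3 [h2]
        ring
      · simp [lift]
  rw [hx]
  refine Prod.ext (funext fun i => ?_) ?_ <;> simp [lift]

/-! ## Brackets -/

theorem exists_eq_nil {m : ℕ} {X : su m} (h11 : ∀ i j, (X : Mat m) (.inl i) (.inl j) = 0)
    (h12 : ∀ i, (X : Mat m) (.inl i) (.inr 0) = 0) (h21 : ∀ j, (X : Mat m) (.inr 1) (.inl j) = 0)
    (h00 : (X : Mat m) (.inr 0) (.inr 0) = 0) (h10 : (X : Mat m) (.inr 1) (.inr 0) = 0)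
    (hd : (X : Mat m) (.inr 1) (.inr 1) = 0) : ∃ v b, X = nil v b := by
  have hX : ∀ i j, ((X : Mat m)ᴴ * Q m + Q m * (X : Mat m)) i j = 0 := fun i j => by
    rw [X.2.1]; rfl
  have hrow : ∀ j, (X : Mat m) (.inr 0) (.inl j) = -star ((X : Mat m) (.inl j) (.inr 1)) := by
    intro j
    have := hX (.inr 1) (.inl j)
    simp [Q, Matrix.mul_apply, Fin.sum_univ_two, Matrix.one_apply] at this
    rw [Complex.star_def]
    linear_combination this
  have him : (X : Mat m) (.inr 0) (.inr 1)
      = Complex.I * (((X : Mat m) (.inr 0) (.inr 1)).im : ℝ) := by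
    have := hX (.inr 1) (.inr 1)
    simp [Q, Matrix.mul_apply, Fin.sum_univ_two] at this
    have h := congrArg Complex.re this
    simp at h
    apply Complex.ext <;> simp
    linarith
  refine ⟨fun i => (X : Mat m) (.inl i) (.inr 1), ((X : Mat m) (.inr 0) (.inr 1)).im,
    Subtype.ext ?_⟩
  ext i j
  change _ = nilMat _ _ _ _
  rcases i with i | i <;> rcases j with j | j
  · simp [nilMat, h11]
  · fin_cases j <;> simp [nilMat, h12]
  · fin_cases i
    · simpa [nilMat] using hrow j
    · simp [nilMat, h21]
  · fin_cases i <;> fin_cases j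
    · simp [nilMat, h00]
    · simpa [nilMat] using him
    · simp [nilMat, h10]
    · simp [nilMat, hd]

/-- `[𝔣, 𝔣] ⊆ 𝔥` because the `A₀`-component of a commutator in `𝔣` vanishes, and the other terms lie
in `𝔫`, which `𝔣` normalizes. -/
theorem exists_bracket_eq {m : ℕ} {F : Subgroup (SU m)} (hF : IsDescription F) {E E' : su m}
    (hE : E ∈ lieAlg F) (hE' : E' ∈ lieAlg F) (v : Fin m → ℂ) (b b' : ℝ) :
    ∃ Y ∈ lieAlg (groupH F), ∃ w β, bracket (E + nil v b) (E' + nil 0 b') = Y + nil w β := by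
  have hc := hF.commute_lieAlg (bracket_mem_lieAlg hF.closed hE hE')
  obtain ⟨B, a, d, hB⟩ := commute_A0_iff.mp (hF.commute_lieAlg hE)
  obtain ⟨B', a', d', hB'⟩ := commute_A0_iff.mp (hF.commute_lieAlg hE')
  have hEE : ((bracket E E' : su m) : Mat m) (.inr 0) (.inr 0) = 0 := by
    change ((E : Mat m) * (E' : Mat m) - (E' : Mat m) * (E : Mat m)) _ _ = 0
    rw [hB, hB', Matrix.fromBlocks_multiply, Matrix.fromBlocks_multiply]
    simp [mul_comm]
  have hZ : ((bracket (E + nil v b) (E' + nil 0 b') - bracket E E' : su m) : Mat m)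
      = (E : Mat m) * nilMat 0 b' + nilMat v b * (E' : Mat m)
        - (E' : Mat m) * nilMat v b - nilMat 0 b' * (E : Mat m)
        + (nilMat v b * nilMat 0 b' - nilMat 0 b' * nilMat v b) := by
    change ((E : Mat m) + nilMat v b) * ((E' : Mat m) + nilMat 0 b')
      - ((E' : Mat m) + nilMat 0 b') * ((E : Mat m) + nilMat v b)
      - ((E : Mat m) * (E' : Mat m) - (E' : Mat m) * (E : Mat m)) = _
    noncomm_ring
  obtain ⟨w, β, hw⟩ : ∃ w β, bracket (E + nil v b) (E' + nil 0 b') - bracket E E' = nil w β := by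
    refine exists_eq_nil ?_ ?_ ?_ ?_ ?_ ?_ <;> intros <;> rw [hZ, hB, hB'] <;>
      simp [nilMat, Matrix.mul_apply, Fin.sum_univ_two]
  refine ⟨bracket E E', mem_lieAlg_inf.mpr ⟨bracket_mem_lieAlg hF.closed hE hE',
    mem_lieAlg_groupM_of_commute hc (by rw [hEE]; rfl)⟩, w, β, ?_⟩
  rw [← hw, add_sub_cancel]

/-! ## Infinitesimal generators at the base point -/

/-- The value at the base point of an infinitesimal generator. -/
def evBase (m : ℕ) : su m →ₗ[ℝ] Model m where
  toFun X := vel (X : Mat m) (0, -1)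
  map_add' X Y := by
    refine Prod.ext (funext fun i => ?_) ?_
    · simp [vel, Matrix.add_mulVec]
    · simp [vel, Matrix.add_mulVec]
      ring
  map_smul' c X := by
    refine Prod.ext (funext fun i => ?_) ?_ <;> simp [vel, Matrix.smul_mulVec]

theorem fund_basePoint {m : ℕ} (X : su m) : fund X (basePoint m) = evBase m X := by
  rw [fund_eq]
  simp only [coordField, affine_basePoint]
  rfl

theorem blockMat_mulVec {m : ℕ} (B : Matrix (Fin m) (Fin m) ℂ) (a d : ℂ) (x : Idx m → ℂ) :
    (Matrix.fromBlocks B 0 0 !![a, 0; 0, d] : Mat m) *ᵥ x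
      = Sum.elim (B *ᵥ fun i => x (.inl i)) ![a * x (.inr 0), d * x (.inr 1)] := by
  rw [Matrix.fromBlocks_mulVec]
  funext i
  rcases i with i | i
  · simp [Function.comp_def]
  · fin_cases i <;> simp [dotProduct, Fin.sum_univ_two]

theorem lift_base (m : ℕ) : lift ((0, -1) : Model m) = Sum.elim (0 : Fin m → ℂ) ![-1, 1] := rfl

theorem evBase_of_mem_groupM {m : ℕ} {X : su m} (hX : X ∈ lieAlg (groupM m)) :
    evBase m X = 0 := by
  obtain ⟨h1, h2⟩ := mem_lieAlg_groupM_iff.mp hX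
  obtain ⟨B, a, d, hB⟩ := commute_A0_iff.mp h1
  rw [hB, commute_swapMat_iff] at h2
  change vel (X : Mat m) (0, -1) = 0
  rw [vel, hB, lift_base, blockMat_mulVec]
  refine Prod.ext (funext fun i => ?_) ?_ <;> simp [h2, Matrix.mulVec, dotProduct]

theorem evBase_of_mem_groupH {m : ℕ} {F : Subgroup (SU m)} {X : su m}
    (hX : X ∈ lieAlg (groupH F)) : evBase m X = 0 :=
  evBase_of_mem_groupM (mem_lieAlg_inf.mp hX).2

theorem evBase_A0 (m : ℕ) : evBase m (A0 m) = (0, -2) := by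
  change vel (Matrix.fromBlocks 0 0 0 !![1, 0; 0, -1]) (0, -1) = _
  rw [vel, lift_base, blockMat_mulVec]
  refine Prod.ext (funext fun i => ?_) ?_ <;> simp
  norm_num

theorem evBase_nil {m : ℕ} (v : Fin m → ℂ) (b : ℝ) :
    evBase m (nil v b) = (v, Complex.I * b) := by
  change vel (nilMat v b) (0, -1) = _
  rw [vel, lift_base, nilMat_mulVec]
  refine Prod.ext (funext fun i => ?_) ?_ <;> simp

theorem IsAr.evBase {m : ℕ} {F : Subgroup (SU m)} {X : su m} (hX : IsAr F X) :
    evBase m X = (0, -2) := by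
  have := evBase_of_mem_groupM hX.sub_mem
  rwa [map_sub, evBase_A0, sub_eq_zero] at this

theorem fderiv_vertical {m : ℕ} (κ : ℂ) (u : Model m) :
    fderiv ℝ (fun q : Model m => ((0 : Fin m → ℂ), height q • κ)) (0, -1) u
      = (0, -u.2.re • κ) := by
  have hdiff : DifferentiableAt ℝ (fun q : Model m => ((0 : Fin m → ℂ), height q • κ)) (0, -1) :=
    (contDiff_vertical κ).contDiffAt.differentiableAt (by simp)
  rw [← hdiff.lineDeriv_eq_fderiv]
  refine HasLineDerivAt.lineDeriv ((hasDerivAt_const (0 : ℝ) (0 : Fin m → ℂ)).prodMk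
    (HasDerivAt.smul_const ?_ κ))
  have h : (fun t : ℝ => height (((0, -1) : Model m) + t • u))
      = fun t : ℝ => -(∑ i, ‖u.1 i‖ ^ 2) / 2 * t ^ 2 + (1 - t * u.2.re) := by
    funext t
    simp only [height, Prod.fst_add, Prod.snd_add, Prod.smul_fst, Prod.smul_snd, zero_add,
      Pi.smul_apply, norm_smul, mul_pow, Real.norm_eq_abs, sq_abs, ← Finset.mul_sum]
    simp
    ring
  rw [h]
  have := (((hasDerivAt_id (0 : ℝ)).pow 2).const_mul (-(∑ i, ‖u.1 i‖ ^ 2) / 2)).add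
    (((hasDerivAt_id (0 : ℝ)).mul_const u.2.re).const_sub 1)
  simpa using! this

/-- The derivative along `B*` at the base point of the difference between a vertical invariant
field and the infinitesimal generator with the same value. -/
theorem fderiv_vertical_sub_fderiv_vel {m : ℕ} {E E' : su m}
    (hE : Commute (E : Mat m) (A0 m : Mat m)) (hE' : Commute (E' : Mat m) (A0 m : Mat m))
    (v : Fin m → ℂ) (b b' : ℝ) {κ : ℂ} (hκ : evBase m (E' + nil 0 b') = (0, κ)) :
    fderiv ℝ (fun q : Model m => ((0 : Fin m → ℂ), height q • κ)) (0, -1) (evBase m (E + nil v b))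
      - fderiv ℝ (vel ((E' + nil 0 b' : su m) : Mat m)) (0, -1) (evBase m (E + nil v b))
      = evBase m (bracket (E + nil v b) (E' + nil 0 b')) := by
  obtain ⟨B, a, d, hB⟩ := commute_A0_iff.mp hE
  obtain ⟨B', a', d', hB'⟩ := commute_A0_iff.mp hE'
  have had := fromBlocks_mem_su hB
  have hval : ∀ (G : su m) (P : Matrix (Fin m) (Fin m) ℂ) (α δ : ℂ) (w : Fin m → ℂ) (β : ℝ),
      (G : Mat m) = Matrix.fromBlocks P 0 0 !![α, 0; 0, δ] →
      evBase m (G + nil w β) = (w, δ - α + Complex.I * β) := by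
    intro G P α δ w β hG
    rw [map_add, evBase_nil]
    change vel (G : Mat m) (0, -1) + _ = _
    rw [vel, hG, lift_base, blockMat_mulVec]
    refine Prod.ext (funext fun i => ?_) ?_ <;> simp [Matrix.mulVec, dotProduct]
    ring
  have hmul : ∀ (G : su m) (P : Matrix (Fin m) (Fin m) ℂ) (α δ : ℂ) (w : Fin m → ℂ) (β : ℝ)
      (x : Idx m → ℂ), (G : Mat m) = Matrix.fromBlocks P 0 0 !![α, 0; 0, δ] →
      ((G + nil w β : su m) : Mat m) *ᵥ x = Sum.elim
        (fun i => (P *ᵥ fun i => x (.inl i)) i + w i * x (.inr 1))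
        ![α * x (.inr 0) - (∑ j, star (w j) * x (.inl j)) + Complex.I * β * x (.inr 1),
          δ * x (.inr 1)] := by
    intro G P α δ w β x hG
    change ((G : Mat m) + nilMat w β) *ᵥ x = _
    rw [Matrix.add_mulVec, nilMat_mulVec, hG, blockMat_mulVec]
    funext i
    rcases i with i | i
    · rfl
    · fin_cases i
      · simp
        ring
      · simp
  rw [hval E' B' a' d' 0 b' hB'] at hκ
  have hκ2 : d' - a' + Complex.I * b' = κ := congrArg Prod.snd hκ
  rw [hval E B a d v b hB, fderiv_vertical, fderiv_vel]
  change _ = vel (((E + nil v b : su m) : Mat m) * ((E' + nil 0 b' : su m) : Mat m)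
    - ((E' + nil 0 b' : su m) : Mat m) * ((E + nil v b : su m) : Mat m)) (0, -1)
  -- Here `d = -conj a`, so `d - a` is real. This matches the real part in the derivative of
  -- `height` with the complex bracket entries.
  have hre : ((((d - a + Complex.I * b).re : ℝ)) : ℂ) = d - a := by
    have h1 := congrArg Complex.re had
    have h2 := congrArg Complex.im had
    simp at h1 h2
    apply Complex.ext <;> simp
    linarith
  have hbase : ∀ X : Mat m, vel X (0, -1) = (fun i => (X *ᵥ lift (0, -1)) (.inl i),
      (X *ᵥ lift (0, -1)) (.inr 0) + (X *ᵥ lift (0, -1)) (.inr 1)) := fun X => by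
    refine Prod.ext (funext fun i => ?_) ?_ <;> simp [vel]
  rw [hbase, Matrix.sub_mulVec, ← Matrix.mulVec_mulVec, ← Matrix.mulVec_mulVec]
  simp only [hmul E B a d v b _ hB, hmul E' B' a' d' 0 b' _ hB', lift_base]
  refine Prod.ext (funext fun i => ?_) ?_
  · simp [dir, Matrix.mulVec, dotProduct]
  · simp [dir, Matrix.mulVec, dotProduct]
    simp at hre
    rw [← hκ2]
    linear_combination -(d' - a' + Complex.I * b') * hre

/-! ## Parallel fields -/

theorem mdifferentiableAt_smul {m : ℕ} (g : SU m) (p : CH m) :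
    MDifferentiableAt 𝓘(ℝ, Model m) 𝓘(ℝ, Model m) (fun q : CH m => g • q) p := by
  have h : ∀ i, Differentiable ℝ fun q : Model m => (toMat m g *ᵥ lift q) i := by
    intro i
    simp only [Matrix.mulVec, dotProduct, lift, Fintype.sum_sum_type, Fin.sum_univ_two,
      Sum.elim_inl, Sum.elim_inr, Matrix.cons_val_zero, Matrix.cons_val_one]
    fun_prop
  have hne : (toMat m g *ᵥ lift (affine p)) (.inr 1) ≠ 0 := by
    refine last_ne_zero ?_
    rw [toMat_apply, herm_mulVec]
    exact lift_affine_neg p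
  have hdiv : ∀ i, DifferentiableAt ℝ (fun q : Model m =>
      (toMat m g *ᵥ lift q) i / (toMat m g *ᵥ lift q) (.inr 1)) (affine p) := fun i => by
    simp only [div_eq_mul_inv]
    refine (h i _).fun_mul (DifferentiableAt.comp (g := fun z : ℂ => z⁻¹)
      (f := fun q : Model m => (toMat m g *ᵥ lift q) (.inr 1)) (affine p) ?_ (h (.inr 1) _))
    exact (differentiableAt_inv (𝕜 := ℂ) hne).restrictScalars ℝ
  have hφ : DifferentiableAt ℝ (fun q : Model m =>
      ((fun i => (toMat m g *ᵥ lift q) (.inl i) / (toMat m g *ᵥ lift q) (.inr 1),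
        (toMat m g *ᵥ lift q) (.inr 0) / (toMat m g *ᵥ lift q) (.inr 1)) : Model m)) (affine p) :=
    (differentiableAt_pi.mpr fun i => hdiv (.inl i)).prodMk (hdiv (.inr 0))
  exact (hasMFDerivAt_of_comp_affine (fun q => affine_smul g q) hφ.hasFDerivAt).mdifferentiableAt

theorem dAct_injective {m : ℕ} (g : SU m) (p : CH m) : Function.Injective (dAct g p) := by
  have h1 := mfderiv_comp p (mdifferentiableAt_smul g⁻¹ (g • p)) (mdifferentiableAt_smul g p)
  have h2 : (fun q : CH m => g⁻¹ • q) ∘ (fun q : CH m => g • q) = id := by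
    funext q
    exact inv_smul_smul g q
  rw [h2, mfderiv_id] at h1
  intro u v huv
  have h3 : ∀ w : TangentSpace 𝓘(ℝ, Model m) p, w = dAct g⁻¹ (g • p) (dAct g p w) := fun w =>
    congrArg (fun L => L w) h1
  rw [h3 u, h3 v, huv]

/-- `∇V` is a `G`-invariant tensor, so it vanishes everywhere once it vanishes at one point of the
orbit. -/
theorem isParallel_of_basePoint {m : ℕ} {G H : Subgroup (SU m)} {𝔪 : Submodule ℝ (su m)}
    {nabla : Connection m} (hnabla : IsCanonicalConnection G H 𝔪 nabla)
    (htrans : ∀ p : CH m, ∃ g ∈ G, g • basePoint m = p) {V : VField m} (hV : IsSmooth V)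
    (hinv : IsInvariantField G V) (h0 : ∀ u, nabla V (basePoint m) u = 0) :
    IsParallel nabla V := by
  intro p v
  obtain ⟨g, hg, hgp⟩ := htrans p
  have hgp' : g⁻¹ • p = basePoint m := by rw [← hgp, inv_smul_smul]
  have h1 := hnabla.invariant g⁻¹ (G.inv_mem hg) V V hV hV (hinv _ (G.inv_mem hg)) p v
  -- The tangent space depends on the point, so the equality of points is substituted for a variable
  -- `q`.
  have h2 : ∀ q, q = basePoint m → ∀ u, nabla V q u = 0 := by
    rintro q rfl
    exact h0
  rw [h2 _ hgp'] at h1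
  exact dAct_injective g⁻¹ p (h1.symm.trans (map_zero _).symm)

/-- Compare the invariant field with `C*`, which has the same value at `o`. The two contributions
are `-[B, C]_𝔪` from the connection and `[B, C]` from the ordinary derivative, both evaluated at
`o`. -/
theorem nabla_vertical_basePoint {m : ℕ} {F : Subgroup (SU m)} (hF : IsDescription F)
    {𝔪 : Submodule ℝ (su m)} (h𝔪 : IsReductiveComplement (groupG F) (groupH F) 𝔪)
    {nabla : Connection m} (hnabla : IsCanonicalConnection (groupG F) (groupH F) 𝔪 nabla)
    {Ar : su m} (hAr : IsAr F Ar) {C E' : su m} {b' : ℝ} (hC : C ∈ 𝔪) (hE' : E' ∈ lieAlg F)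
    (hCE : C = E' + nil 0 b') {κ : ℂ} (hκ : evBase m C = (0, κ))
    (u : TangentSpace 𝓘(ℝ, Model m) (basePoint m)) :
    nabla (vertical κ) (basePoint m) u = 0 := by
  obtain ⟨u, rfl⟩ : ∃ u' : Model m, u' = u := ⟨u, rfl⟩
  have hnil : ∀ v b, nil v b ∈ lieAlg (groupG F) := fun v b =>
    lieAlg_mono le_sup_right (nil_mem_lieAlg v b)
  obtain ⟨Y₁, hY₁, Z₁, hZ₁, hA⟩ := h𝔪.span Ar (lieAlg_mono le_sup_left hAr.mem)
  obtain ⟨Y₂, hY₂, Z₂, hZ₂, hN⟩ := h𝔪.span _ (hnil u.1 u.2.im)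
  -- `A_r` takes the value `(0, -2)` at `o` and `nil v b` the value `(v, ib)`. Subtracting `𝔥`-parts
  -- changes no value and puts the combination `B` with `B*_o = u` into `𝔪`.
  set s : ℝ := -u.2.re / 2 with hs
  have hH : groupH F ≤ F := inf_le_left
  set E : su m := s • (Ar - Y₁) - Y₂ with hE
  have hEF : E ∈ lieAlg F := (lieSubmodule F hF.closed).sub_mem
    ((lieSubmodule F hF.closed).smul_mem s
      ((lieSubmodule F hF.closed).sub_mem hAr.mem (lieAlg_mono hH hY₁))) (lieAlg_mono hH hY₂)
  have hB : E + nil u.1 u.2.im ∈ 𝔪 := by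
    have : E + nil u.1 u.2.im = s • Z₁ + Z₂ := by
      rw [hE, hN, hA]
      module
    rw [this]
    exact 𝔪.add_mem (𝔪.smul_mem _ hZ₁) hZ₂
  have hev : evBase m (E + nil u.1 u.2.im) = u := by
    rw [hE, map_add, map_sub, map_smul, map_sub, hAr.evBase, evBase_of_mem_groupH hY₁,
      evBase_of_mem_groupH hY₂, evBase_nil]
    refine Prod.ext ?_ ?_
    · simp
    · apply Complex.ext <;> simp [hs]
  obtain ⟨Y, hY, w, β, hbr⟩ := exists_bracket_eq hF hEF hE' u.1 u.2.im b'
  rw [← hCE] at hbr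
  obtain ⟨Y₃, hY₃, D, hD, hw⟩ := h𝔪.span _ (hnil w β)
  have hYY : Y + Y₃ ∈ lieAlg (groupH F) := add_mem_lieAlg (isClosed_groupH hF.closed) hY hY₃
  have hbrD : bracket (E + nil u.1 u.2.im) C = (Y + Y₃) + D := by rw [hbr, hw, add_assoc]
  have hat := hnabla.at_base _ hB C hC D hD (by rw [hbrD, add_sub_cancel_right]; exact hYY)
  -- `D` is the `𝔪`-part of the bracket, and the `𝔥`-part is invisible at `o`.
  have hevD : evBase m D = evBase m (bracket (E + nil u.1 u.2.im) C) := by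
    rw [hbrD, map_add, evBase_of_mem_groupH hYY, zero_add]
  rw [fund_basePoint, fund_basePoint, hev, hevD] at hat
  set ψ : Model m → Model m := (fun q => ((0 : Fin m → ℂ), height q • κ)) - vel (C : Mat m)
  have hd1 : DifferentiableAt ℝ (fun q : Model m => ((0 : Fin m → ℂ), height q • κ)) (0, -1) :=
    (contDiff_vertical κ).contDiffAt.differentiableAt (by simp)
  have hd2 : DifferentiableAt ℝ (vel (C : Mat m)) (0, -1) :=
    (contDiff_vel _).contDiffAt.differentiableAt (by simp)
  have hψ : DifferentiableAt ℝ ψ (affine (basePoint m)) := by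
    rw [affine_basePoint]
    exact hd1.sub hd2
  have hψ0 : ψ (affine (basePoint m)) = 0 := by
    rw [affine_basePoint]
    change ((0 : Fin m → ℂ), height (0, -1) • κ) - evBase m C = 0
    rw [hκ]
    simp [height]
  have hdiff := nabla_coordField_of_eq_zero nabla hψ hψ0 u
  rw [affine_basePoint, fderiv_sub hd1 hd2] at hdiff
  have hkey := fderiv_vertical_sub_fderiv_vel (hF.commute_lieAlg hEF) (hF.commute_lieAlg hE')
    u.1 u.2.im b' (hCE ▸ hκ)
  rw [hev, ← hCE] at hkey
  have hsplit : (vertical κ : VField m) = fund C + coordField ψ := by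
    rw [fund_eq]
    funext p
    exact (add_sub_cancel (vel (C : Mat m) (affine p)) _).symm
  have hadd : nabla (fund C + coordField ψ) (basePoint m)
      = nabla (fund C) (basePoint m) + nabla (coordField ψ) (basePoint m) := by
    rw [fund_eq]
    exact nabla.isCovariantDerivativeOnUniv.add
      (mdifferentiableAt_coordField _ (by rw [affine_basePoint]; exact hd2))
      (mdifferentiableAt_coordField _ hψ)
  rw [hsplit, hadd]
  refine (congrArg₂ (fun a b : Model m => a + b) hat (hdiff.trans hkey)).trans ?_
  exact neg_add_cancel (evBase m (bracket (E + nil u.1 u.2.im) C))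

theorem vertical_ne_zero {m : ℕ} {κ : ℂ} (hκ : κ ≠ 0) (p : CH m) :
    (vertical κ : VField m) p ≠ 0 := by
  intro h
  have h1 : height (affine p) • κ = 0 := congrArg Prod.snd (show
    (((0 : Fin m → ℂ), height (affine p) • κ) : Model m) = 0 from h)
  exact smul_ne_zero (height_pos p).ne' hκ h1

end ComplexHyperbolic

end

/-! ### The main theorem: the two parallel fields -/

open ComplexHyperbolic in
theorem mainTheorem5 (m : ℕ) (F : Subgroup (SU m)) (hF : IsDescription F)
    (𝔪 : Submodule ℝ (su m)) (h𝔪 : IsReductiveComplement (groupG F) (groupH F) 𝔪)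
    (nabla : Connection m) (hnabla : IsCanonicalConnection (groupG F) (groupH F) 𝔪 nabla) :
    ∃ Ar At Nt : su m,
      IsAr F Ar ∧
      At ∈ 𝔪 ∧ At - Ar ∈ lieAlg (groupH F) ∧
      Nt ∈ 𝔪 ∧ Nt - N2 m ∈ lieAlg (groupH F) ∧
      ∃ U V : VField m,
        IsInducedBy (groupG F) At U ∧ IsInducedBy (groupG F) Nt V ∧
        IsParallel nabla U ∧ IsParallel nabla V ∧
        (∀ p, U p ≠ 0) ∧ (∀ p, V p ≠ 0) ∧ ∀ p, LinearIndependent ℝ ![U p, V p] := by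
  obtain ⟨Ar, hAr⟩ := hF.exists_isAr
  obtain ⟨Y, hY, At, hAt, hA⟩ := h𝔪.span Ar (lieAlg_mono le_sup_left hAr.mem)
  obtain ⟨Y', hY', Nt, hNt, hN⟩ := h𝔪.span (N2 m) (lieAlg_mono le_sup_right (nil_mem_lieAlg 0 1))
  have hneg : ∀ {X : su m}, X ∈ lieAlg (groupH F) → -X ∈ lieAlg (groupH F) := fun {X} hX => by
    rw [← neg_one_smul ℝ X]
    exact smul_mem_lieAlg hX _
  have hAtY : At - Ar = -Y := by rw [hA]; abel
  have hNtY : Nt - N2 m = -Y' := by rw [hN]; abel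
  have hevA : evBase m At = (0, -2) := by
    rw [← hAr.evBase, hA, map_add, evBase_of_mem_groupH hY, zero_add]
  have hevN : evBase m Nt = (0, Complex.I) := by
    have h1 : evBase m (N2 m) = (0, Complex.I) := by
      rw [N2, evBase_nil]
      simp
    rw [← h1, hN, map_add, evBase_of_mem_groupH hY', zero_add]
  have hnil0 : (nil 0 0 : su m) = 0 := by
    have := smul_nil 0 (0 : Fin m → ℂ) 0
    rw [zero_smul, smul_zero, mul_zero] at this
    exact this.symm
  have hU := isInducedBy_vertical hF (X := At) hevA
  have hV := isInducedBy_vertical hF (X := Nt) hevN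
  -- The constants `-2` and `i` are the vertical values of `Ã₀` and `Ñ₂` at `o`, where `height` is
  -- `1`. In the form `E' + nil 0 b'`, the element `Ã₀` lies in `𝔣` itself, so `b' = 0`, while `Ñ₂`
  -- is `N₂` plus an element of `𝔥`, so `b' = 1`.
  refine ⟨Ar, At, Nt, hAr, hAt, hAtY ▸ hneg hY, hNt, hNtY ▸ hneg hY', vertical (-2),
    vertical Complex.I, hU, hV,
    isParallel_of_basePoint hnabla hAr.exists_smul_basePoint hU.smooth hU.invariant
      (nabla_vertical_basePoint hF h𝔪 hnabla hAr hAt (E' := At) (b' := 0) ?_ ?_ hevA),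
    isParallel_of_basePoint hnabla hAr.exists_smul_basePoint hV.smooth hV.invariant
      (nabla_vertical_basePoint hF h𝔪 hnabla hAr hNt (E' := -Y') (b' := 1) ?_ ?_ hevN),
    vertical_ne_zero (by norm_num), vertical_ne_zero Complex.I_ne_zero, fun p => ?_⟩
  · have : At = Ar - Y := by rw [hA]; abel
    rw [this]
    exact (lieSubmodule F hF.closed).sub_mem hAr.mem (lieAlg_mono inf_le_left hY)
  · rw [hnil0, add_zero]
  · exact lieAlg_mono inf_le_left (hneg hY')
  · rw [← hNtY]
    exact (sub_add_cancel Nt (N2 m)).symm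
  · rw [LinearIndependent.pair_iff]
    intro s t hst
    have h1 : s • (height (affine p) • (-2 : ℂ)) + t • (height (affine p) • Complex.I) = 0 :=
      congrArg Prod.snd (show (s • ((0 : Fin m → ℂ), height (affine p) • (-2 : ℂ))
        + t • ((0 : Fin m → ℂ), height (affine p) • Complex.I) : Model m) = 0 from hst)
    have hp := (height_pos p).ne'
    have hre := congrArg Complex.re h1
    have him := congrArg Complex.im h1
    simp [hp] at hre him
    exact ⟨hre, him⟩
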